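/- **Bike-sharing networks.** A network consists of a finite set $\mathcal J_1$ of $J_1$ stations, an irreducible stochastic matrix $Q=(q_{ij})_{i,j\in\mathcal J_1}$, the set of routes $\mathcal J_2=\{[ij] : q_{ij}>0\}$ and service rates $\mu_a>0$ for the nodes $a\in\mathcal J_1\cup\mathcal J_2$. With $M$ bikes, it is the continuous-time Markov process on $\{n\in\mathbb N^{\mathcal J_1\cup\mathcal J_2}:\sum_a n_a=M\}$ in which a bike leaves station $i$ for route $[ij]$ at rate $\mu_i q_{ij}\mathbf 1_{n_i>0}$ and leaves route $[ij]$ for station $j$ at rate $\mu_{[ij]}n_{[ij]}$. Let $\nu$ be the invariant distribution of $Q$. The utilizations are $$r_j=\frac{\nu_j}{2\mu_j}\quad(j\in\mathcal J_1),\qquad r_{[ij]}=\frac{\nu_iq_{ij}}{2\mu_{[ij]}}\quad([ij]\in\mathcal J_2).$$ **Corollary 5.1.** Consider a sequence of such networks, indexed by $N$ (all quantities receive an index $N$), whose number of nodes $J_1^N+|\mathcal J_2^N|$ tends to infinity. Fix $\delta\in(0,1]$ and put $$\gamma_N=\frac{1-\delta}{\max_{j\in\mathcal J_1^N}r_{j,N}},\qquad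 a_N=\sum_{j\in\mathcal J_1^N}\frac{\gamma_Nr_{j,N}}{1-\gamma_Nr_{j,N}}+\sum_{[ij]\in\mathcal J_2^N}\gamma_Nr_{[ij],N}.$$ Let the number of bikes be $M_N=a_N$, rounded to an integer if necessary; that is, $M_N\in\mathbb N$ is any integer with $|M_N-a_N|<1$. Let $\xi_N=(\xi_{a,N})_a$ have the stationary law of the network with $M_N$ bikes. Assume that $$\liminf_{N\to\infty}\frac{\min_{j\in\mathcal J_1^N}r_{j,N}}{\max_{j\in\mathcal J_1^N}r_{j,N}}>0 .$$ For a station $j$ let $p_{j,N}(x)=(1-\gamma_Nr_{j,N})(\gamma_Nr_{j,N})^x$ be the geometric distribution with parameter $\gamma_Nr_{j,N}=(1-\delta)r_{j,N}/\max_{i\in\mathcal J_1^N} r_{i,N}$. For a route $[ij]$ let $p_{[ij],N}(x)=e^{-\gamma_Nr_{[ij],N}}(\gamma_Nr_{[ij],N})^x/x!$ be the Poisson distribution with parameter $\gamma_Nr_{[ij],N}=(1-\delta)r_{[ij],N}/\max_{k\in\mathcal J_1^N} r_{k,N}$. (i) The stationary queue-lengths at the stations are asymptotically independent and approximately geometric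 with these parameters: for all $K\in\mathbb N$, $x\in\mathbb N^K$ and $\varepsilon>0$, for all sufficiently large $N$ and all distinct stations $a_1,\dots,a_K\in\mathcal J_1^N$, $$\Bigl|\mathbb P(\xi_{a_1,N}=x_1,\dots,\xi_{a_K,N}=x_K)-\prod_{k=1}^Kp_{a_k,N}(x_k)\Bigr|\le\varepsilon\prod_{k=1}^Kp_{a_k,N}(x_k).$$ (ii) If moreover $$\lim_{N\to\infty}\frac{\max_{[ij]\in\mathcal J_2^N}r_{[ij],N}}{\sqrt{J_1^N}\,\max_{k\in\mathcal J_1^N}r_{k,N}}=0,$$ then stations and routes are jointly asymptotically independent, geometric and Poisson respectively: the statement in (i) holds for all distinct nodes $a_1,\dots,a_K\in\mathcal J_1^N\cup\mathcal J_2^N$. -/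

import Mathlib

open Filter Topology

noncomputable section

namespace BikeSharing

/-! ### Closed Jackson networks with infinite node capacities -/

section Jackson

variable {V : Type*} [Fintype V] [DecidableEq V]

/-- The state space: all ways of placing `M` customers at the nodes `V`. -/
def configurations (V : Type*) [Fintype V] [DecidableEq V] (M : ℕ) : Finset (V → ℕ) :=
  Finset.univ.piAntidiag M

/-- The jump rate from the configuration `n` to the configuration `m`: a customer leaves node `i`
at rate `g i (n i)` and is routed to node `j` with probability `P i j`, which turns `n` into
`n - e_i + e_j`. (If `n i = 0` then `g i (n i) = 0`, so that the truncated subtraction is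
harmless.) -/
def jumpRate (g : V → ℕ → ℝ) (P : Matrix V V ℝ) (n m : V → ℕ) : ℝ :=
  ∑ i, ∑ j, if m = n - Pi.single i 1 + Pi.single j 1 then g i (n i) * P i j else 0

/-- `π` is a stationary law of the node-occupation process with `M` customers: a probability mass
function on the state space that satisfies the global balance equations. -/
structure IsStationaryLaw (g : V → ℕ → ℝ) (P : Matrix V V ℝ) (M : ℕ) (π : (V → ℕ) → ℝ) :
    Prop where
  nonneg : ∀ n, 0 ≤ π n
  support : ∀ n, n ∉ configurations V M → π n = 0
  sum_eq_one : ∑ n ∈ configurations V M, π n = 1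
  balance : ∀ m ∈ configurations V M,
    ∑ n ∈ configurations V M, π n * jumpRate g P n m =
      π m * ∑ n ∈ configurations V M, jumpRate g P m n

/-- The probability, under the law `π` of the configuration `ξ` of `M` customers, that
`ξ (e k) = x k` for all `k`. -/
def marginal (M : ℕ) (π : (V → ℕ) → ℝ) {K : ℕ} (e : Fin K → V) (x : Fin K → ℕ) : ℝ :=
  ∑ n ∈ configurations V M with ∀ k, n (e k) = x k, π n

end Jackson

/-- `ν` is an invariant probability distribution of the transition matrix `Q`. -/
structure IsInvariantDistribution {ι : Type*} [Fintype ι] (Q : Matrix ι ι ℝ) (ν : ι → ℝ) :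
    Prop where
  nonneg : ∀ i, 0 ≤ ν i
  sum_eq_one : ∑ i, ν i = 1
  invariant : ∀ j, ∑ i, ν i * Q i j = ν j

/-- The geometric distribution with parameter `ρ`. -/
def geometricMass (ρ : ℝ) (k : ℕ) : ℝ := (1 - ρ) * ρ ^ k

/-- The Poisson distribution with parameter `l`. -/
def poissonMass (l : ℝ) (k : ℕ) : ℝ := Real.exp (-l) * l ^ k / (k.factorial : ℝ)

/-! ### The bike-sharing network -/

/-- The routes `[ij]`: the pairs of stations `(i, j)` with `q i j > 0`. -/
abbrev Route {J : ℕ} (q : Matrix (Fin J) (Fin J) ℝ) : Type :=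
  {p : Fin J × Fin J // 0 < q p.1 p.2}

/-- The nodes of the network: the stations and the routes. -/
abbrev Node {J : ℕ} (q : Matrix (Fin J) (Fin J) ℝ) : Type := Fin J ⊕ Route q

/-- The data of a bike-sharing network with infinite capacities. -/
structure Network where
  /-- the number of stations -/
  J : ℕ
  /-- `q i j` is the probability that a user who takes a bike at station `i` returns it at `j` -/
  q : Matrix (Fin J) (Fin J) ℝ
  row_sum : ∀ i, ∑ j, q i j = 1
  irreducible : q.IsIrreducible
  /-- `μ` of a station is the arrival rate of its users; `μ` of a route is the parameter of the
  exponential ride durations on it -/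
  μ : Node q → ℝ
  μ_pos : ∀ a, 0 < μ a

namespace Network

variable (net : Network)

/-- The number of nodes. -/
def numNodes : ℕ := Fintype.card (Node net.q)

/-- The routing matrix: from station `i` to route `[ij]` with probability `q i j`, and from route
`[ij]` to station `j` with probability one. -/
def routing : Matrix (Node net.q) (Node net.q) ℝ
  | .inl i, .inr r => if r.1.1 = i then net.q r.1.1 r.1.2 else 0
  | .inr r, .inl j => if r.1.2 = j then 1 else 0
  | _, _ => 0

/-- The departure rate from a node at which `k` bikes are present: stations are single-server
nodes, routes are infinite-server nodes. -/
def departureRate : Node net.q → ℕ → ℝ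
  | .inl i, k => if k = 0 then 0 else net.μ (.inl i)
  | .inr r, k => net.μ (.inr r) * k

/-- Stationary laws of the numbers of bikes at the nodes, for `M` bikes. -/
def IsStationary (M : ℕ) (π : (Node net.q → ℕ) → ℝ) : Prop :=
  IsStationaryLaw net.departureRate net.routing M π

variable (ν : Fin net.J → ℝ)

/-- The utilizations of the nodes, where `ν` is the invariant distribution of `q`. -/
def utilization : Node net.q → ℝ
  | .inl j => ν j / (2 * net.μ (.inl j))
  | .inr r => ν r.1.1 * net.q r.1.1 r.1.2 / (2 * net.μ (.inr r))

/-- The maximal utilization of a station. -/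
def maxStation : ℝ := ⨆ j : Fin net.J, net.utilization ν (.inl j)

/-- The minimal utilization of a station. -/
def minStation : ℝ := ⨅ j : Fin net.J, net.utilization ν (.inl j)

/-- The maximal utilization of a route. -/
def maxRoute : ℝ := ⨆ r : Route net.q, net.utilization ν (.inr r)

/-- The factor `γ = (1 - δ) / max r_j`. -/
def gammaFactor (δ : ℝ) : ℝ := (1 - δ) / net.maxStation ν

/-- The total mean of independent variables, geometric with parameter `γ r_j` at the stations and
Poisson with parameter `γ r_[ij]` at the routes, for `γ = gammaFactor`. -/
def totalMean (δ : ℝ) : ℝ :=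
  ∑ j : Fin net.J, net.gammaFactor ν δ * net.utilization ν (.inl j) /
      (1 - net.gammaFactor ν δ * net.utilization ν (.inl j)) +
    ∑ r : Route net.q, net.gammaFactor ν δ * net.utilization ν (.inr r)

/-- The approximating distribution at a node: geometric at a station, Poisson at a route, with
parameter `γ` times the utilization. -/
def approxMass (δ : ℝ) : Node net.q → ℕ → ℝ
  | .inl j => geometricMass (net.gammaFactor ν δ * net.utilization ν (.inl j))
  | .inr r => poissonMass (net.gammaFactor ν δ * net.utilization ν (.inr r))

end Network

end BikeSharing

end

open Filter Topology

noncomputable section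

namespace BikeSharing

/-! ### Fourier inversion for the total weight of configurations with a given number of customers.
-/

section Fourier

open Complex

variable {V : Type*} [DecidableEq V]

/-! A closed Jackson network has a product-form stationary law (`IsStationaryLaw.mul_sum_eq_prod`).
The traffic equations are homogeneous, so the weights may be taken to be the geometric and Poisson
masses with parameters `γ r_a`, for any `γ > 0`. The stationary law is thus that of independent
variables conditioned on their sum being `M`, and `γ` is tuned so that `M` is within 1 of the mean
of this sum.

By `marginal_mul_sum_eq` a marginal equals the product of masses times `N / D`. Here `D` is the
probability that the free sum is `M`, and `N` is the same quantity after the observed nodes have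
been frozen at the observed values. It remains to show that `N / D` tends to 1.

Both are Fourier integrals (`integral_prod_fourierSeries`). Let `S`, at least the number of
stations, be the order of the variance. Comparison with a Gaussian gives `D ≥ const / √S`
(`le_norm_integral_prod`). Freezing nodes alters the integrand by `O(|t|)` times a Gaussian of width
`1/√S`, so `|N - D| = O(T / S)`, where `T` sums the observed values and means
(`norm_integral_prod_sub_prod_le`). The relative error is `O(T / √S)`. It vanishes because station
means are bounded and, in the second part, route means are `o(√J)`. -/

lemma sum_piAntidiag_insert {R : Type*} [CommSemiring R] (p : V → ℕ → R) {s : Finset V} {i : V}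
    (hi : i ∉ s) (n : ℕ) :
    ∑ f ∈ (insert i s).piAntidiag n, ∏ b ∈ insert i s, p b (f b) =
      ∑ kl ∈ Finset.HasAntidiagonal.antidiagonal n, p i kl.1 * ∑ f ∈ s.piAntidiag kl.2, ∏ b ∈ s, p b (f b) := by
  rw [← Finset.cons_eq_insert _ _ hi, Finset.piAntidiag_cons, Finset.sum_disjiUnion]
  refine Finset.sum_congr rfl fun kl _ => ?_
  rw [Finset.sum_map, Finset.mul_sum]
  refine Finset.sum_congr rfl fun f hf => ?_
  rw [Finset.mem_piAntidiag] at hf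
  have h0 : f i = 0 := by
    by_contra h
    exact hi (hf.2 i h)
  rw [Finset.prod_cons]
  congr 1
  · simp [h0]
  · refine Finset.prod_congr rfl fun b hb => ?_
    have : b ≠ i := fun h => hi (h ▸ hb)
    simp [this]

/-- Iterated Cauchy product. Absolute summability is carried through the induction because the next
Cauchy product needs it. -/
lemma summable_norm_and_tsum_piAntidiag (p : V → ℕ → ℂ) (hp : ∀ b, Summable fun k => ‖p b k‖)
    (s : Finset V) :
    (Summable fun n => ‖∑ f ∈ s.piAntidiag n, ∏ b ∈ s, p b (f b)‖) ∧
      ∑' n, ∑ f ∈ s.piAntidiag n, ∏ b ∈ s, p b (f b) = ∏ b ∈ s, ∑' k, p b k := by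
  induction s using Finset.induction_on with
  | empty =>
    have h : ∀ n, n ≠ 0 → ∑ f ∈ (∅ : Finset V).piAntidiag n, ∏ b ∈ ∅, p b (f b) = 0 := by
      intro n hn
      simp [hn]
    constructor
    · refine summable_of_ne_finset_zero (s := {0}) fun n hn => ?_
      rw [h n (by simpa using hn), norm_zero]
    · rw [tsum_eq_single 0 h]
      simp
  | insert i s hi ih =>
    have h := sum_piAntidiag_insert p hi
    rw [Finset.prod_insert hi, ← ih.2,
      tsum_mul_tsum_eq_tsum_sum_antidiagonal_of_summable_norm (hp i) ih.1]
    refine ⟨?_, tsum_congr h⟩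
    simp only [h]
    exact summable_norm_sum_mul_antidiagonal_of_summable_norm (f := p i)
      (g := fun n => ∑ f ∈ s.piAntidiag n, ∏ b ∈ s, p b (f b)) (hp i) ih.1

variable [Fintype V]

/-- The Fourier transform of a sequence. -/
def fourierSeries (p : ℕ → ℝ) (t : ℝ) : ℂ := ∑' k : ℕ, (p k : ℂ) * exp (I * (k * t))

lemma norm_exp_I_mul_nat_mul (k : ℕ) (t : ℝ) : ‖exp (I * (k * t))‖ = 1 := by
  have := norm_exp_I_mul_ofReal (k * t)
  push_cast at this
  exact this

lemma hasSum_prod_fourierSeries (p : V → ℕ → ℝ) (hp : ∀ b, Summable (p b)) (t : ℝ) :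
    HasSum (fun n : ℕ => ((∑ f ∈ configurations V n, ∏ b, p b (f b) : ℝ) : ℂ) * exp (I * (n * t)))
      (∏ b, fourierSeries (p b) t) := by
  have key := summable_norm_and_tsum_piAntidiag
    (fun b (k : ℕ) => (p b k : ℂ) * exp (I * (k * t)))
    (fun b => by simpa [norm_exp_I_mul_nat_mul] using (hp b).abs) Finset.univ
  have h : ∀ n : ℕ, ((∑ f ∈ configurations V n, ∏ b, p b (f b) : ℝ) : ℂ) * exp (I * (n * t)) =
      ∑ f ∈ Finset.univ.piAntidiag n, ∏ b, (p b (f b) : ℂ) * exp (I * (f b * t)) := by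
    intro n
    push_cast
    rw [Finset.sum_mul]
    refine Finset.sum_congr rfl fun f hf => ?_
    rw [Finset.prod_mul_distrib, ← Complex.exp_sum, ← Finset.mul_sum, ← Finset.sum_mul]
    rw [Finset.mem_piAntidiag] at hf
    rw [← hf.1]
    push_cast
    rfl
  simp_rw [h]
  have := key.1.of_norm.hasSum
  rw [key.2] at this
  exact this

lemma integral_exp_int_mul (k : ℤ) :
    ∫ t in (-Real.pi)..Real.pi, exp (I * (k * t)) = if k = 0 then 2 * Real.pi else 0 := by
  split_ifs with hk
  · simp [hk]; ring
  · have hc : (I * k : ℂ) ≠ 0 := mul_ne_zero I_ne_zero (by exact_mod_cast hk)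
    have := integral_exp_mul_complex (a := -Real.pi) (b := Real.pi) hc
    simp only [← mul_assoc]
    rw [this]
    refine div_eq_zero_iff.2 (Or.inl ?_)
    rw [sub_eq_zero, exp_eq_exp_iff_exists_int]
    exact ⟨k, by push_cast; ring⟩

/-- The weight of the configurations of `m` customers as a Fourier coefficient. -/
lemma integral_prod_fourierSeries (p : V → ℕ → ℝ) (hp : ∀ b, Summable (p b))
    (hp0 : ∀ b k, 0 ≤ p b k) (m : ℕ) :
    ∫ t in (-Real.pi)..Real.pi, (∏ b, fourierSeries (p b) t) * exp (-(I * (m * t))) =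
      2 * Real.pi * ((∑ f ∈ configurations V m, ∏ b, p b (f b) : ℝ) : ℂ) := by
  set c : ℕ → ℝ := fun n => ∑ f ∈ configurations V n, ∏ b, p b (f b) with hc
  have hc0 : ∀ n, 0 ≤ c n := fun n =>
    Finset.sum_nonneg fun f _ => Finset.prod_nonneg fun b _ => hp0 b _
  have hcs : Summable c := by
    -- At `t = 0` the exponentials are 1. The resulting summable majorant `c` justifies integrating
    -- term by term.
    have := (hasSum_prod_fourierSeries p hp 0).summable
    refine Complex.summable_ofReal.1 (this.congr fun n => ?_)
    simp [hc]
  let F : ℕ → C(ℝ, ℂ) := fun n =>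
    ⟨fun t => (c n : ℂ) * exp (I * (((n : ℤ) - m : ℤ) * t)), by fun_prop⟩
  have hF : ∀ n t, F n t = (c n : ℂ) * exp (I * (n * t)) * exp (-(I * (m * t))) := by
    intro n t
    simp only [F, ContinuousMap.coe_mk]
    rw [mul_assoc, ← Complex.exp_add]
    congr 2
    push_cast
    ring
  have hsum : ∀ t : ℝ, HasSum (fun n => F n t)
      ((∏ b, fourierSeries (p b) t) * exp (-(I * (m * t)))) := by
    intro t
    simp_rw [hF]
    exact (hasSum_prod_fourierSeries p hp t).mul_right _
  have hnorm : ∀ n, ‖(F n).restrict (⟨Set.uIcc (-Real.pi) Real.pi, isCompact_uIcc⟩ :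
      TopologicalSpace.Compacts ℝ)‖ ≤ c n := by
    intro n
    rw [ContinuousMap.norm_le _ (hc0 n)]
    intro t
    simp only [F, ContinuousMap.restrict_apply, ContinuousMap.coe_mk, norm_mul, norm_real,
      Real.norm_eq_abs, abs_of_nonneg (hc0 n)]
    have := norm_exp_I_mul_ofReal ((((n : ℤ) - m : ℤ) : ℝ) * t)
    push_cast at this ⊢
    rw [this, mul_one]
  have h1 := intervalIntegral.hasSum_intervalIntegral_of_summable_norm (a := -Real.pi)
    (b := Real.pi) (f := F) (Summable.of_nonneg_of_le (fun _ => norm_nonneg _) hnorm hcs)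
  have h2 : ∀ n, ∫ t in (-Real.pi)..Real.pi, F n t = if n = m then 2 * Real.pi * (c m : ℂ) else 0 := by
    intro n
    simp only [F, ContinuousMap.coe_mk]
    rw [intervalIntegral.integral_const_mul, integral_exp_int_mul]
    by_cases h : n = m
    · subst h; simp; ring
    · have : (n : ℤ) - m ≠ 0 := by omega
      simp [h, this]
  simp_rw [h2] at h1
  have h3 := h1.unique (hasSum_ite_eq m _)
  rw [← h3]
  refine intervalIntegral.integral_congr fun t _ => (hsum t).tsum_eq.symm

end Fourier

/-! ### Local limit estimates from bounds on characteristic functions. -/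

section LocalLimit

open Complex

/-- Bounds on the characteristic function `φ` of a law on `ℕ` with mean `m`, variance `v` and scale
`s`, which make sums of such independent variables satisfy a local limit theorem. -/
structure CharFunBounds (κ C : ℝ) (φ : ℝ → ℂ) (m v s : ℝ) : Prop where
  continuous : Continuous φ
  mean_nonneg : 0 ≤ m
  scale_nonneg : 0 ≤ s
  scale_le_var : 2 * κ * s ≤ v
  var_le_scale : v ≤ C * s
  norm_le : ∀ t : ℝ, |t| ≤ Real.pi → ‖φ t‖ ≤ Real.exp (-(κ * s * t ^ 2))
  norm_sub_one_le : ∀ t : ℝ, ‖φ t - 1‖ ≤ m * |t|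
  norm_sub_gaussian_le : ∀ t : ℝ, |t| ≤ Real.pi →
    ‖φ t - exp (I * (m * t) - v * t ^ 2 / 2)‖ ≤ C * s * |t| ^ 3 * Real.exp (-(κ * s * t ^ 2))

/-- Telescoping, with errors measured relative to the bounds `b i`. The full product of the `b i`,
hence all their Gaussian decay, survives in front of the sum of errors. -/
lemma norm_prod_sub_prod_le {ι : Type*} (A : Finset ι) (z w : ι → ℂ) (b d : ι → ℝ)
    (hz : ∀ i ∈ A, ‖z i‖ ≤ b i) (hw : ∀ i ∈ A, ‖w i‖ ≤ b i)
    (hd : ∀ i ∈ A, ‖z i - w i‖ ≤ d i * b i) :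
    ‖∏ i ∈ A, z i - ∏ i ∈ A, w i‖ ≤ (∑ i ∈ A, d i) * ∏ i ∈ A, b i := by
  induction A using Finset.cons_induction with
  | empty => simp
  | cons a A ha ih =>
    simp only [Finset.mem_cons, forall_eq_or_imp] at hz hw hd
    rw [Finset.prod_cons, Finset.prod_cons, Finset.prod_cons, Finset.sum_cons]
    have hb : ‖∏ i ∈ A, z i‖ ≤ ∏ i ∈ A, b i := by
      rw [norm_prod]
      exact Finset.prod_le_prod (fun _ _ => norm_nonneg _) hz.2
    have ha0 : 0 ≤ b a := (norm_nonneg _).trans hz.1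
    calc ‖z a * ∏ i ∈ A, z i - w a * ∏ i ∈ A, w i‖
        = ‖(z a - w a) * ∏ i ∈ A, z i + w a * (∏ i ∈ A, z i - ∏ i ∈ A, w i)‖ := by
          congr 1; ring
      _ ≤ ‖z a - w a‖ * ‖∏ i ∈ A, z i‖ + ‖w a‖ * ‖∏ i ∈ A, z i - ∏ i ∈ A, w i‖ := by
          refine (norm_add_le _ _).trans ?_
          rw [norm_mul, norm_mul]
      _ ≤ d a * b a * (∏ i ∈ A, b i) + b a * ((∑ i ∈ A, d i) * ∏ i ∈ A, b i) := by
          refine add_le_add (mul_le_mul hd.1 hb (norm_nonneg _) ((norm_nonneg _).trans hd.1))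
            (mul_le_mul hw.1 (ih hz.2 hw.2 hd.2) (norm_nonneg _) ha0)
      _ = _ := by ring

lemma integral_abs_mul_exp_neg_le {a : ℝ} (ha : 0 < a) :
    ∫ t in (-Real.pi)..Real.pi, |t| * Real.exp (-(a * t ^ 2)) ≤ 1 / a := by
  have hcont : Continuous fun t : ℝ => |t| * Real.exp (-(a * t ^ 2)) := by fun_prop
  have hder : ∀ c t : ℝ, HasDerivAt (fun t => c * (Real.exp (-(a * t ^ 2)) / (2 * a)))
      (-c * (t * Real.exp (-(a * t ^ 2)))) t := by
    intro c t
    have h1 : HasDerivAt (fun t : ℝ => -(a * t ^ 2)) (-(a * (2 * t))) t := by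
      simpa using (((hasDerivAt_id t).pow 2).const_mul a).fun_neg
    refine ((h1.exp.div_const (2 * a)).const_mul c).congr_deriv ?_
    field_simp
  have hpi := Real.pi_pos.le
  have hr : ∫ t in (0 : ℝ)..Real.pi, |t| * Real.exp (-(a * t ^ 2)) ≤ 1 / (2 * a) := by
    rw [intervalIntegral.integral_eq_sub_of_hasDerivAt (fun t ht => ?_)
      (hcont.intervalIntegrable _ _) (f := fun t => (-1) * (Real.exp (-(a * t ^ 2)) / (2 * a)))]
    · have : 0 ≤ Real.exp (-(a * Real.pi ^ 2)) / (2 * a) := by positivity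
      simp only [ne_eq, OfNat.ofNat_ne_zero, not_false_eq_true, zero_pow, mul_zero, neg_zero,
        Real.exp_zero]
      linarith
    · rw [Set.uIcc_of_le hpi] at ht
      rw [abs_of_nonneg ht.1]
      simpa using hder (-1) t
  have hl : ∫ t in (-Real.pi)..0, |t| * Real.exp (-(a * t ^ 2)) ≤ 1 / (2 * a) := by
    rw [intervalIntegral.integral_eq_sub_of_hasDerivAt (fun t ht => ?_)
      (hcont.intervalIntegrable _ _) (f := fun t => 1 * (Real.exp (-(a * t ^ 2)) / (2 * a)))]
    · have : 0 ≤ Real.exp (-(a * (-Real.pi) ^ 2)) / (2 * a) := by positivity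
      simp only [ne_eq, OfNat.ofNat_ne_zero, not_false_eq_true, zero_pow, mul_zero, neg_zero,
        Real.exp_zero]
      linarith
    · rw [Set.uIcc_of_le (by linarith)] at ht
      rw [abs_of_nonpos ht.2]
      simpa using hder 1 t
  rw [← intervalIntegral.integral_add_adjacent_intervals (b := 0)
    (hcont.intervalIntegrable _ _) (hcont.intervalIntegrable _ _)]
  have : 1 / a = 1 / (2 * a) + 1 / (2 * a) := by field_simp; norm_num
  linarith

/-- The source of the gain: with `a` of order `S`, a factor `|t|` lowers the integral from order
`1/√S` to order `1/S`. -/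
lemma norm_integral_le_of_norm_le_abs_mul_exp {f : ℝ → ℂ} {a B : ℝ} (ha : 0 < a) (hB : 0 ≤ B)
    (hf : ∀ t : ℝ, |t| ≤ Real.pi → ‖f t‖ ≤ B * (|t| * Real.exp (-(a * t ^ 2)))) :
    ‖∫ t in (-Real.pi)..Real.pi, f t‖ ≤ B / a := by
  have hcont : Continuous fun t : ℝ => B * (|t| * Real.exp (-(a * t ^ 2))) := by fun_prop
  refine (intervalIntegral.norm_integral_le_of_norm_le (by linarith [Real.pi_pos])
    (Eventually.of_forall fun t ht => hf t (abs_le.2 ⟨ht.1.le, ht.2⟩))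
    (hcont.intervalIntegrable _ _)).trans ?_
  rw [intervalIntegral.integral_const_mul, div_eq_mul_one_div]
  exact mul_le_mul_of_nonneg_left (integral_abs_mul_exp_neg_le ha) hB

/-- Only the window `|t| ≤ 1/√S` is kept; there the exponent is at least `-C/2`. -/
lemma le_integral_gaussian {σ C S : ℝ} (hS : 1 ≤ S) (hσ0 : 0 ≤ σ) (hσ : σ ≤ C * S) :
    2 * Real.exp (-(C / 2)) / √S ≤ ∫ t in (-Real.pi)..Real.pi, Real.exp (-(σ * t ^ 2 / 2)) := by
  have hcont : Continuous fun t : ℝ => Real.exp (-(σ * t ^ 2 / 2)) := by fun_prop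
  have hS0 : 0 < √S := Real.sqrt_pos.2 (by linarith)
  set r := 1 / √S with hr
  have hr0 : 0 < r := by positivity
  have hr1 : r ≤ 1 := by
    rw [hr, div_le_one hS0]
    exact Real.one_le_sqrt.2 hS
  have hrS : S * r ^ 2 = 1 := by
    rw [hr, div_pow, Real.sq_sqrt (by linarith)]
    field_simp
  have hpi := Real.pi_gt_three
  have h1 : ∫ t in (-r)..r, Real.exp (-(C / 2)) ≤ ∫ t in (-r)..r, Real.exp (-(σ * t ^ 2 / 2)) := by
    refine intervalIntegral.integral_mono_on (by linarith) (by simp)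
      (hcont.intervalIntegrable _ _) fun t ht => ?_
    refine Real.exp_le_exp.2 (neg_le_neg ?_)
    have h2 : t ^ 2 ≤ r ^ 2 := sq_le_sq' ht.1 ht.2
    have h3 : σ * t ^ 2 ≤ C * S * r ^ 2 := by gcongr; exact hσ0.trans hσ
    rw [mul_assoc, hrS] at h3
    linarith
  have h4 := intervalIntegral.integral_mono_interval (μ := MeasureTheory.volume)
    (f := fun t : ℝ => Real.exp (-(σ * t ^ 2 / 2)))
    (show -Real.pi ≤ -r by linarith) (by linarith) (show r ≤ Real.pi by linarith)
    (Eventually.of_forall fun t => (Real.exp_pos _).le) (hcont.intervalIntegrable _ _)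
  refine le_trans (le_of_eq ?_) (h1.trans h4)
  rw [intervalIntegral.integral_const, smul_eq_mul, hr]
  ring

lemma norm_exp_I_mul_sub_one_le (x : ℝ) : ‖exp (I * x) - 1‖ ≤ |x| :=
  Real.norm_exp_I_mul_ofReal_sub_one_le

variable {V : Type*} [Fintype V] {κ C : ℝ} {φ : V → ℝ → ℂ} {m v s : V → ℝ}

/-- Each factor is replaced by the Gaussian of the same mean and variance, at a total cost `C S
|t|³` times the decay. The offset of `n` from the mean costs a further `|t|`. Both integrate to
`O(1/S)`. -/
lemma norm_integral_prod_sub_gaussian_le (hκ : 0 < κ) (hC : 0 ≤ C)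
    (h : ∀ b, CharFunBounds κ C (φ b) (m b) (v b) (s b)) (hS : 0 < ∑ b, s b) {n : ℝ}
    (hn : |n - ∑ b, m b| ≤ 1) :
    ‖(∫ t in (-Real.pi)..Real.pi, (∏ b, φ b t) * exp (-(I * (n * t)))) -
      ((∫ t in (-Real.pi)..Real.pi, Real.exp (-((∑ b, v b) * t ^ 2 / 2)) : ℝ) : ℂ)‖ ≤
      (1 + 2 * C / κ) / (κ / 2 * ∑ b, s b) := by
  set S := ∑ b, s b with hSdef
  have hφ : ∀ b, Continuous (φ b) := fun b => (h b).continuous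
  rw [← intervalIntegral.integral_ofReal, ← intervalIntegral.integral_sub
    ((by fun_prop : Continuous _).intervalIntegrable _ _)
    ((by fun_prop : Continuous _).intervalIntegrable _ _)]
  refine norm_integral_le_of_norm_le_abs_mul_exp (by positivity) (by positivity) fun t ht => ?_
  set w : V → ℂ := fun b => exp (I * (m b * t) - v b * t ^ 2 / 2) with hw
  have hwn : ∀ b, ‖w b‖ ≤ Real.exp (-(κ * s b * t ^ 2)) := by
    intro b
    have : (I * (m b * t) - v b * t ^ 2 / 2 : ℂ).re = -(v b * t ^ 2 / 2) := by
      simp [← ofReal_pow]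
    rw [hw, norm_exp, this, Real.exp_le_exp]
    nlinarith [mul_le_mul_of_nonneg_right (h b).scale_le_var (sq_nonneg t)]
  have hprod := norm_prod_sub_prod_le Finset.univ (fun b => φ b t) w
    (fun b => Real.exp (-(κ * s b * t ^ 2))) (fun b => C * s b * |t| ^ 3)
    (fun b _ => (h b).norm_le t ht) (fun b _ => hwn b) (fun b _ => (h b).norm_sub_gaussian_le t ht)
  have hE : ∏ b, Real.exp (-(κ * s b * t ^ 2)) = Real.exp (-(κ * S * t ^ 2)) := by
    rw [← Real.exp_sum, Finset.sum_neg_distrib, ← Finset.sum_mul, ← Finset.mul_sum]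
  rw [hE, ← Finset.sum_mul, ← Finset.mul_sum, ← hSdef] at hprod
  have hW : ∏ b, w b = exp (I * ((∑ b, m b : ℝ) * t)) *
      exp (-((∑ b, v b : ℝ) * t ^ 2 / 2)) := by
    rw [hw, ← Complex.exp_sum, ← Complex.exp_add, Finset.sum_sub_distrib, ← Finset.mul_sum,
      ← Finset.sum_mul, ← Finset.sum_div, ← Finset.sum_mul]
    push_cast
    ring_nf
  have hWn : ‖∏ b, w b‖ ≤ Real.exp (-(κ * S * t ^ 2)) := by
    rw [norm_prod, ← hE]
    exact Finset.prod_le_prod (fun _ _ => norm_nonneg _) fun b _ => hwn b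
  have hsplit : (∏ b, φ b t) * exp (-(I * (n * t))) -
      ((Real.exp (-((∑ b, v b) * t ^ 2 / 2)) : ℝ) : ℂ) =
      (∏ b, φ b t - ∏ b, w b) * exp (I * ((-(n * t) : ℝ) : ℂ)) +
      (∏ b, w b) * exp (I * ((-(n * t) : ℝ) : ℂ)) *
        (1 - exp (I * (((n - ∑ b, m b) * t : ℝ) : ℂ))) := by
    have h1 : (∏ b, w b) * exp (I * ((-(n * t) : ℝ) : ℂ)) *
        exp (I * (((n - ∑ b, m b) * t : ℝ) : ℂ)) =
        ((Real.exp (-((∑ b, v b) * t ^ 2 / 2)) : ℝ) : ℂ) := by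
      rw [hW, ← Complex.exp_add, ← Complex.exp_add, ← Complex.exp_add]
      push_cast
      congr 1
      ring
    rw [← h1]
    push_cast
    rw [mul_neg]
    ring
  rw [hsplit]
  refine (norm_add_le _ _).trans ?_
  rw [norm_mul, norm_mul, norm_mul, norm_exp_I_mul_ofReal, mul_one, mul_one, norm_sub_rev 1]
  have h3 : ‖exp (I * (((n - ∑ b, m b) * t : ℝ) : ℂ)) - 1‖ ≤ |t| := by
    refine (norm_exp_I_mul_sub_one_le _).trans ?_
    rw [abs_mul]
    exact mul_le_of_le_one_left (abs_nonneg _) hn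
  -- Half of the decay is spent on absorbing `S t²`, which reduces `S |t|³` to a multiple of `|t|`;
  -- the other half is kept for the integration.
  have hexp : Real.exp (-(κ * S * t ^ 2)) =
      Real.exp (-(κ / 2 * S * t ^ 2)) * Real.exp (-(κ / 2 * S * t ^ 2)) := by
    rw [← Real.exp_add]; ring_nf
  have hle1 : Real.exp (-(κ / 2 * S * t ^ 2)) ≤ 1 := by
    rw [Real.exp_le_one_iff]
    have : 0 ≤ κ / 2 * S * t ^ 2 := by positivity
    linarith
  have hle2 : κ / 2 * S * t ^ 2 * Real.exp (-(κ / 2 * S * t ^ 2)) ≤ 1 := by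
    have h4 := Real.add_one_le_exp (κ / 2 * S * t ^ 2)
    rw [Real.exp_neg, ← div_eq_mul_inv, div_le_one (Real.exp_pos _)]
    linarith
  set E := Real.exp (-(κ / 2 * S * t ^ 2)) with hEdef
  have hE0 : 0 < E := Real.exp_pos _
  have ht3 : |t| ^ 3 = |t| * t ^ 2 := by rw [pow_succ' , sq_abs]
  have h5 : C * S * |t| ^ 3 * (E * E) ≤ 2 * C / κ * (|t| * E) := by
    have : C * S * |t| ^ 3 * (E * E) = 2 * C / κ * (|t| * E) * (κ / 2 * S * t ^ 2 * E) := by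
      rw [ht3]; field_simp
    rw [this]
    exact mul_le_of_le_one_right (by positivity) hle2
  have h6 : E * E * |t| ≤ |t| * E := by
    have := mul_le_mul_of_nonneg_left hle1 (show 0 ≤ |t| * E by positivity)
    linarith
  rw [hexp] at hprod hWn
  calc _ ≤ C * S * |t| ^ 3 * (E * E) + E * E * |t| :=
        add_le_add hprod (mul_le_mul hWn h3 (norm_nonneg _) (by positivity))
    _ ≤ 2 * C / κ * (|t| * E) + |t| * E := add_le_add h5 h6
    _ = _ := by ring

/-- On `A` both the frozen and the original factor are bounded by 1 and lie within `y |t|` and `m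
|t|` of 1. The decay therefore comes from the complement of `A` alone. -/
lemma norm_integral_prod_sub_prod_le [DecidableEq V] (hκ : 0 < κ)
    (h : ∀ b, CharFunBounds κ C (φ b) (m b) (v b) (s b)) (A : Finset V) (y : V → ℕ)
    (hS : 0 < ∑ b ∈ Aᶜ, s b) (n : ℝ) :
    ‖(∫ t in (-Real.pi)..Real.pi, (∏ b, if b ∈ A then exp (I * (y b * t)) else φ b t) *
        exp (-(I * (n * t)))) -
      ∫ t in (-Real.pi)..Real.pi, (∏ b, φ b t) * exp (-(I * (n * t)))‖ ≤
      (∑ b ∈ A, (y b + m b)) / (κ * ∑ b ∈ Aᶜ, s b) := by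
  have hφ : ∀ b, Continuous (φ b) := fun b => (h b).continuous
  have hc : ∀ b, Continuous fun t : ℝ => if b ∈ A then exp (I * (y b * t)) else φ b t := by
    intro b
    split_ifs
    · fun_prop
    · exact hφ b
  rw [← intervalIntegral.integral_sub
    ((by fun_prop : Continuous _).intervalIntegrable _ _)
    ((by fun_prop : Continuous _).intervalIntegrable _ _)]
  have hsum0 : 0 ≤ ∑ b ∈ A, (y b + m b) :=
    Finset.sum_nonneg fun b _ => add_nonneg (Nat.cast_nonneg _) (h b).mean_nonneg
  refine norm_integral_le_of_norm_le_abs_mul_exp (by positivity) hsum0 fun t ht => ?_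
  have hy : ∀ b, ‖exp (I * (y b * t))‖ = 1 := fun b => norm_exp_I_mul_nat_mul _ _
  have hprod := norm_prod_sub_prod_le Finset.univ
    (fun b => if b ∈ A then exp (I * (y b * t)) else φ b t) (fun b => φ b t)
    (fun b => if b ∈ A then 1 else Real.exp (-(κ * s b * t ^ 2)))
    (fun b => if b ∈ A then (y b + m b) * |t| else 0)
    (fun b _ => by
      split_ifs
      · exact (hy b).le
      · exact (h b).norm_le t ht)
    (fun b _ => by
      split_ifs
      · refine ((h b).norm_le t ht).trans (Real.exp_le_one_iff.2 ?_)
        have := (h b).scale_nonneg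
        have : 0 ≤ κ * s b * t ^ 2 := by positivity
        linarith
      · exact (h b).norm_le t ht)
    (fun b _ => by
      split_ifs
      · have h1 : ‖exp (I * (y b * t)) - 1‖ ≤ y b * |t| := by
          have := norm_exp_I_mul_sub_one_le (y b * t)
          rw [abs_mul, Nat.abs_cast] at this
          push_cast at this
          exact this
        have h2 := (h b).norm_sub_one_le t
        calc _ = ‖(exp (I * (y b * t)) - 1) - (φ b t - 1)‖ := by congr 1; ring
          _ ≤ _ := (norm_sub_le _ _).trans (by linarith)
      · simp)
  rw [← sub_mul, norm_mul]
  have hn : ‖exp (-(I * (n * t)))‖ = 1 := by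
    have := norm_exp_I_mul_ofReal (-(n * t))
    push_cast at this
    rwa [mul_neg] at this
  rw [hn, mul_one]
  refine hprod.trans (le_of_eq ?_)
  have hE : ∏ b, (if b ∈ A then 1 else Real.exp (-(κ * s b * t ^ 2))) =
      Real.exp (-(κ * (∑ b ∈ Aᶜ, s b) * t ^ 2)) := by
    rw [Finset.prod_ite, Finset.prod_const_one, one_mul, ← Real.exp_sum, Finset.sum_neg_distrib,
      ← Finset.sum_mul, ← Finset.mul_sum]
    congr 5
    ext; simp
  rw [hE, Finset.sum_ite, Finset.sum_const_zero, add_zero, ← Finset.sum_mul, mul_assoc]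
  rw [Finset.filter_mem_eq_inter, Finset.univ_inter]

lemma le_norm_integral_prod (hκ : 0 < κ) (hC : 0 ≤ C)
    (h : ∀ b, CharFunBounds κ C (φ b) (m b) (v b) (s b)) (hS : 1 ≤ ∑ b, s b) {n : ℝ}
    (hn : |n - ∑ b, m b| ≤ 1) :
    2 * Real.exp (-(C / 2)) / √(∑ b, s b) - (1 + 2 * C / κ) / (κ / 2 * ∑ b, s b) ≤
    ‖∫ t in (-Real.pi)..Real.pi, (∏ b, φ b t) * exp (-(I * (n * t)))‖ := by
  have h1 := norm_integral_prod_sub_gaussian_le hκ hC h (by linarith) hn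
  have h2 := le_integral_gaussian (σ := ∑ b, v b) (C := C) hS
    (Finset.sum_nonneg fun b _ => by
      have := (h b).scale_nonneg
      exact le_trans (by positivity) (h b).scale_le_var)
    (by rw [Finset.mul_sum]; exact Finset.sum_le_sum fun b _ => (h b).var_le_scale)
  have h3 := norm_sub_norm_le
    ((∫ t in (-Real.pi)..Real.pi, Real.exp (-((∑ b, v b) * t ^ 2 / 2)) : ℝ) : ℂ)
    (∫ t in (-Real.pi)..Real.pi, (∏ b, φ b t) * exp (-(I * (n * t))))
  rw [norm_sub_rev] at h3
  have h4 := h3.trans h1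
  rw [norm_real] at h4
  have h5 := Real.le_norm_self (∫ t in (-Real.pi)..Real.pi, Real.exp (-((∑ b, v b) * t ^ 2 / 2)))
  linarith

end LocalLimit

/-! ### Uniform characteristic function bounds for geometric and Poisson laws. -/

section NodeLaws

open Complex

/-- Mean value inequality on a half-plane, which is convex and on which the derivative is at most
`exp a`. -/
lemma norm_exp_sub_exp_le {z w : ℂ} {a : ℝ} (hz : z.re ≤ a) (hw : w.re ≤ a) :
    ‖exp z - exp w‖ ≤ Real.exp a * ‖z - w‖ := by
  refine Convex.norm_image_sub_le_of_norm_hasDerivWithin_le (s := {c : ℂ | c.re ≤ a}) (f' := exp)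
    (fun x _ => (Complex.hasDerivAt_exp x).hasDerivWithinAt) (fun x hx => ?_)
    (convex_halfSpace_re_le a) hw hz
  rw [norm_exp]
  exact Real.exp_le_exp.2 hx

lemma norm_exp_I_mul_taylor_le {t : ℝ} (ht : |t| ≤ Real.pi) :
    ‖exp (I * t) - 1 - (I * t - t ^ 2 / 2)‖ ≤ Real.exp 4 * |t| ^ 3 := by
  have h := norm_exp_sub_sum_le_norm_mul_exp (I * t) 3
  have hn : ‖(I * t : ℂ)‖ = |t| := by simp
  rw [hn] at h
  have h2 : exp (I * t) - 1 - (I * t - t ^ 2 / 2) =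
      exp (I * t) - ∑ m ∈ Finset.range 3, (I * t : ℂ) ^ m / m.factorial := by
    simp [Finset.sum_range_succ, mul_pow]
    ring
  rw [h2]
  refine h.trans ?_
  rw [mul_comm]
  gcongr
  linarith [Real.pi_lt_four]

lemma two_div_pi_sq_mul_le (t : ℝ) (ht : |t| ≤ Real.pi) :
    2 / Real.pi ^ 2 * t ^ 2 ≤ 1 - Real.cos t := by
  linarith [Real.cos_le_one_sub_mul_cos_sq ht]

/-- Writing the sum through the mean `m = ρ / (1 - ρ)` makes its reciprocal affine in `m`, the form
used in all later estimates. -/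
lemma hasSum_geometricMass_mul {ρ : ℝ} (h0 : 0 ≤ ρ) (h1 : ρ < 1) (t : ℝ) :
    HasSum (fun k : ℕ => (geometricMass ρ k : ℂ) * exp (I * (k * t)))
      (1 - (ρ / (1 - ρ) : ℝ) * (exp (I * t) - 1))⁻¹ := by
  have hz : ‖(ρ : ℂ) * exp (I * t)‖ < 1 := by
    rw [norm_mul, norm_exp_I_mul_ofReal, mul_one, norm_real, Real.norm_eq_abs, abs_of_nonneg h0]
    exact h1
  have hs := (hasSum_geometric_of_norm_lt_one hz).mul_left ((1 - ρ : ℝ) : ℂ)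
  have hρ : ((1 - ρ : ℝ) : ℂ) ≠ 0 := by
    exact_mod_cast (sub_pos.2 h1).ne'
  have hlim : (1 - (ρ / (1 - ρ) : ℝ) * (exp (I * t) - 1) : ℂ)⁻¹ =
      ((1 - ρ : ℝ) : ℂ) * (1 - ρ * exp (I * t))⁻¹ := by
    rw [← div_eq_mul_inv, ← inv_div]
    push_cast at hρ ⊢
    field_simp
    ring
  rw [hlim]
  refine hs.congr_fun fun k => ?_
  rw [geometricMass, mul_pow, ← Complex.exp_nat_mul]
  push_cast
  rw [mul_assoc]
  congr 3
  ring_nf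

lemma summable_geometricMass {ρ : ℝ} (h0 : 0 ≤ ρ) (h1 : ρ < 1) : Summable (geometricMass ρ) :=
  (summable_geometric_of_lt_one h0 h1).mul_left _

lemma geometricMass_pos {ρ : ℝ} (h0 : 0 < ρ) (h1 : ρ < 1) (k : ℕ) : 0 < geometricMass ρ k :=
  mul_pos (sub_pos.2 h1) (pow_pos h0 k)

lemma poissonMass_pos {l : ℝ} (h0 : 0 < l) (k : ℕ) : 0 < poissonMass l k := by
  unfold poissonMass; positivity

lemma summable_poissonMass (l : ℝ) : Summable (poissonMass l) := by
  unfold poissonMass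
  simp_rw [mul_div_assoc]
  exact (Real.summable_pow_div_factorial l).mul_left _

lemma hasSum_poissonMass_mul (l t : ℝ) :
    HasSum (fun k : ℕ => (poissonMass l k : ℂ) * exp (I * (k * t)))
      (exp (l * (exp (I * t) - 1))) := by
  have h := (NormedSpace.expSeries_div_hasSum_exp ((l : ℂ) * exp (I * t))).mul_left (exp (-l))
  rw [← Complex.exp_eq_exp_ℂ, ← Complex.exp_add] at h
  rw [show (l * (exp (I * t) - 1) : ℂ) = -l + l * exp (I * t) by ring]
  refine h.congr_fun fun k => ?_
  rw [poissonMass, mul_pow, ← Complex.exp_nat_mul]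
  push_cast
  rw [show (I * (k * t) : ℂ) = k * (I * t) by ring]
  ring

lemma normSq_one_sub_mul_exp_sub_one (m t : ℝ) :
    ‖1 - m * (exp (I * t) - 1)‖ ^ 2 = 1 + 2 * (m + m ^ 2) * (1 - Real.cos t) := by
  rw [← Complex.normSq_eq_norm_sq, mul_comm I, Complex.normSq_apply]
  simp only [sub_re, one_re, mul_re, ofReal_re, ofReal_im, sub_im, mul_im, one_im,
    exp_ofReal_mul_I_re, exp_ofReal_mul_I_im]
  linear_combination m ^ 2 * Real.sin_sq_add_cos_sq t

/-- The decay rate of the characteristic functions of geometric laws with mean at least `m₀`. -/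
def decayRate (m₀ : ℝ) : ℝ := 2 * m₀ / (Real.pi ^ 2 * (1 + 4 * m₀))

lemma decayRate_pos {m₀ : ℝ} (h : 0 < m₀) : 0 < decayRate m₀ := by
  unfold decayRate; positivity

lemma decayRate_mul_pi_sq_le {m₀ : ℝ} (h : 0 < m₀) : decayRate m₀ * Real.pi ^ 2 ≤ 1 := by
  have : decayRate m₀ * Real.pi ^ 2 = 2 * m₀ / (1 + 4 * m₀) := by
    unfold decayRate; field_simp
  rw [this, div_le_one (by positivity)]
  linarith

lemma decayRate_le {m₀ : ℝ} (h : 0 < m₀) : decayRate m₀ ≤ 1 / 9 := by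
  have h1 := decayRate_mul_pi_sq_le h
  have h2 : 9 ≤ Real.pi ^ 2 := by nlinarith [Real.pi_gt_three]
  nlinarith [decayRate_pos h]

lemma two_mul_decayRate_le {m₀ : ℝ} (h : 0 < m₀) : 2 * decayRate m₀ ≤ m₀ := by
  unfold decayRate
  rw [← mul_div_assoc, div_le_iff₀ (by positivity)]
  have h2 : 9 ≤ Real.pi ^ 2 := by nlinarith [Real.pi_gt_three]
  have h3 : 9 ≤ Real.pi ^ 2 * (1 + 4 * m₀) := by nlinarith
  nlinarith

/-- The squared modulus of the denominator is at least `1 + y` with `y = 4 m₀ t² / π² ≤ 4 m₀`. Then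
`1 + y ≥ exp (y / (1 + y)) ≥ exp (y / (1 + 4 m₀))`, which explains the form of `decayRate`. -/
lemma norm_inv_one_sub_mul_exp_sub_one_le {m₀ m t : ℝ} (h0 : 0 < m₀) (hm : m₀ ≤ m)
    (ht : |t| ≤ Real.pi) :
    ‖(1 - m * (exp (I * t) - 1))⁻¹‖ ≤ Real.exp (-(decayRate m₀ * t ^ 2)) := by
  have hm0 : 0 < m := h0.trans_le hm
  set y := 4 / Real.pi ^ 2 * m₀ * t ^ 2 with hy
  have hy0 : 0 ≤ y := by positivity
  have hpi := Real.pi_pos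
  have ht2 : t ^ 2 ≤ Real.pi ^ 2 := sq_le_sq' (abs_le.1 ht).1 (abs_le.1 ht).2
  have hyle : y ≤ 4 * m₀ := by
    rw [hy, div_mul_eq_mul_div, div_mul_eq_mul_div, div_le_iff₀ (by positivity)]
    nlinarith
  have hD : 1 + y ≤ ‖1 - m * (exp (I * t) - 1)‖ ^ 2 := by
    rw [normSq_one_sub_mul_exp_sub_one]
    have h1 := two_div_pi_sq_mul_le t ht
    have h2 : m₀ * (2 / Real.pi ^ 2 * t ^ 2) ≤ (m + m ^ 2) * (1 - Real.cos t) := by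
      gcongr
      nlinarith
    have h3 : y = 2 * (m₀ * (2 / Real.pi ^ 2 * t ^ 2)) := by rw [hy]; ring
    linarith
  have hexp : Real.exp (2 * (decayRate m₀ * t ^ 2)) ≤ 1 + y := by
    have h1 : 2 * (decayRate m₀ * t ^ 2) = y / (1 + 4 * m₀) := by
      rw [hy, decayRate]; field_simp; ring
    have h2 : y / (1 + 4 * m₀) ≤ y / (1 + y) := by gcongr
    have h3 := Real.add_one_le_exp (-(y / (1 + y)))
    have h4 : -(y / (1 + y)) + 1 = (1 + y)⁻¹ := by field_simp; ring
    rw [h4, Real.exp_neg] at h3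
    rw [h1]
    exact (Real.exp_le_exp.2 h2).trans ((inv_le_inv₀ (by positivity) (Real.exp_pos _)).1 h3)
  rw [norm_inv, Real.exp_neg]
  gcongr
  refine le_of_sq_le_sq ?_ (norm_nonneg _)
  rw [← Real.exp_nat_mul]
  exact_mod_cast hexp.trans hD

lemma one_le_norm_one_sub_mul_exp_sub_one {m : ℝ} (hm : 0 ≤ m) (t : ℝ) :
    1 ≤ ‖1 - m * (exp (I * t) - 1)‖ := by
  refine le_of_sq_le_sq ?_ (norm_nonneg _)
  rw [normSq_one_sub_mul_exp_sub_one]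
  have := Real.cos_le_one t
  have h2 : 0 ≤ 2 * (m + m ^ 2) * (1 - Real.cos t) :=
    mul_nonneg (by positivity) (by linarith)
  linarith

/-- The constant in the third-order comparison of a geometric law of mean `m` with a Gaussian. -/
def taylorConst (m : ℝ) : ℝ :=
  (m + 2 * (m + m ^ 2)) ^ 3 * Real.exp (4 * (m + 2 * (m + m ^ 2))) + m * (m + m ^ 2) +
    (m + m ^ 2) ^ 2 + m * Real.exp 4

/-- With `D` the denominator and `exp (-w)` the Gaussian, `D⁻¹ - exp (-w) = exp (-w) D⁻¹ (exp w -
D)`, and the prefactor has modulus at most 1. So it suffices to compare `exp w` with `D`. -/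
lemma norm_inv_sub_gaussian_le {m t : ℝ} (hm : 0 ≤ m) (ht : |t| ≤ Real.pi) :
    ‖(1 - m * (exp (I * t) - 1))⁻¹ - exp (I * (m * t) - (m + m ^ 2 : ℝ) * t ^ 2 / 2)‖ ≤
      taylorConst m * |t| ^ 3 := by
  set v := m + m ^ 2 with hv
  have hv0 : 0 ≤ v := by positivity
  have ht4 : |t| ≤ 4 := ht.trans Real.pi_lt_four.le
  have ha := abs_nonneg t
  set D : ℂ := 1 - m * (exp (I * t) - 1) with hD
  have hD1 : 1 ≤ ‖D‖ := one_le_norm_one_sub_mul_exp_sub_one hm t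
  have hD0 : D ≠ 0 := norm_pos_iff.1 (by linarith)
  set w : ℂ := -(I * (m * t)) + v * t ^ 2 / 2 with hw
  set r : ℂ := exp (I * t) - 1 - (I * t - t ^ 2 / 2) with hr
  have hrn : ‖r‖ ≤ Real.exp 4 * |t| ^ 3 := norm_exp_I_mul_taylor_le ht
  have hwn : ‖w‖ ≤ (m + 2 * v) * |t| := by
    have h1 : ‖(I * (m * t) : ℂ)‖ = m * |t| := by simp [abs_of_nonneg hm]
    have h2 : ‖(v * t ^ 2 / 2 : ℂ)‖ = v * (|t| * |t|) / 2 := by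
      simp [abs_of_nonneg hv0, sq]
    refine (norm_add_le _ _).trans ?_
    rw [norm_neg, h1, h2]
    nlinarith [mul_le_mul_of_nonneg_left ht4 (mul_nonneg hv0 ha)]
  have hE : exp (I * (m * t) - v * t ^ 2 / 2) = exp (-w) := by
    congr 1; rw [hw]; ring
  have hEn : ‖exp (-w)‖ ≤ 1 := by
    have h1 : (-w).re = -(v * t ^ 2 / 2) := by
      rw [hw]; simp [← ofReal_pow]
    rw [norm_exp, h1, Real.exp_le_one_iff]
    have : 0 ≤ v * t ^ 2 / 2 := by positivity
    linarith
  have hkey : D⁻¹ - exp (-w) = exp (-w) * D⁻¹ * (exp w - D) := by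
    have : exp (-w) * exp w = 1 := by rw [← Complex.exp_add]; simp
    rw [mul_sub, mul_assoc, mul_assoc, inv_mul_cancel₀ hD0, mul_one, mul_comm D⁻¹, ← mul_assoc,
      this, one_mul]
  -- The terms up to order `t²` cancel precisely because the variance is `v = m + m²`.
  have hdiff : exp w - D = (exp w - ∑ k ∈ Finset.range 3, w ^ k / k.factorial) +
      (-(I * (m * v * t ^ 3 / 2)) + v ^ 2 * t ^ 4 / 8 + m * r) := by
    have hv' : (v : ℂ) = m + m ^ 2 := by rw [hv]; push_cast; ring
    have hDr : D = 1 - m * (r + (I * t - t ^ 2 / 2)) := by rw [hD, hr]; ring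
    have hw2 : w ^ 2 = -(m ^ 2 * t ^ 2) - I * (m * v * t ^ 3) + v ^ 2 * t ^ 4 / 4 := by
      rw [hw]
      linear_combination (m ^ 2 * t ^ 2 : ℂ) * Complex.I_sq
    simp only [Finset.sum_range_succ, Finset.sum_range_zero, pow_zero, pow_one, hw2]
    rw [hDr, hw]
    simp
    rw [hv']
    ring
  have h1 : ‖exp w - ∑ k ∈ Finset.range 3, w ^ k / k.factorial‖ ≤
      (m + 2 * v) ^ 3 * Real.exp (4 * (m + 2 * v)) * |t| ^ 3 := by
    refine (norm_exp_sub_sum_le_norm_mul_exp w 3).trans ?_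
    have h2 : ‖w‖ ≤ 4 * (m + 2 * v) :=
      hwn.trans (by nlinarith [mul_le_mul_of_nonneg_left ht4 (show 0 ≤ m + 2 * v by positivity)])
    calc ‖w‖ ^ 3 * Real.exp ‖w‖ ≤ ((m + 2 * v) * |t|) ^ 3 * Real.exp (4 * (m + 2 * v)) := by gcongr
      _ = _ := by ring
  have h3 : ‖(-(I * (m * v * t ^ 3 / 2)) + v ^ 2 * t ^ 4 / 8 + m * r : ℂ)‖ ≤
      (m * v + v ^ 2 + m * Real.exp 4) * |t| ^ 3 := by
    have e1 : ‖(I * (m * v * t ^ 3 / 2) : ℂ)‖ = m * v * |t| ^ 3 / 2 := by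
      simp [abs_of_nonneg hm, abs_of_nonneg hv0]
    have e2 : ‖(v ^ 2 * t ^ 4 / 8 : ℂ)‖ = v ^ 2 * (|t| * |t| ^ 3) / 8 := by
      rw [← pow_succ']
      simp [abs_of_nonneg hv0]
    have e3 : ‖(m * r : ℂ)‖ ≤ m * (Real.exp 4 * |t| ^ 3) := by
      rw [norm_mul, norm_real, Real.norm_eq_abs, abs_of_nonneg hm]
      gcongr
    refine (norm_add_le _ _).trans ?_
    refine (add_le_add_left (norm_add_le _ _) _).trans ?_
    rw [norm_neg, e1, e2]
    have e4 : |t| * |t| ^ 3 ≤ 4 * |t| ^ 3 := by gcongr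
    have e5 : v ^ 2 * (|t| * |t| ^ 3) ≤ v ^ 2 * (4 * |t| ^ 3) := by gcongr
    have e6 : 0 ≤ m * v * |t| ^ 3 := by positivity
    have e7 : 0 ≤ v ^ 2 * |t| ^ 3 := by positivity
    linarith
  rw [hE, hkey, norm_mul, norm_mul, norm_inv]
  have h4 : ‖exp (-w)‖ * ‖D‖⁻¹ ≤ 1 :=
    mul_le_one₀ hEn (by positivity) (inv_le_one_of_one_le₀ hD1)
  refine (mul_le_of_le_one_left (norm_nonneg _) h4).trans ?_
  rw [hdiff, taylorConst]
  refine (norm_add_le _ _).trans ((add_le_add h1 h3).trans (le_of_eq ?_))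
  ring

lemma taylorConst_mono {m m₁ : ℝ} (h0 : 0 ≤ m) (h : m ≤ m₁) : taylorConst m ≤ taylorConst m₁ := by
  have h1 : 0 ≤ m₁ := h0.trans h
  unfold taylorConst
  gcongr

lemma taylorConst_nonneg {m : ℝ} (h0 : 0 ≤ m) : 0 ≤ taylorConst m := by
  unfold taylorConst; positivity

/-- A constant that serves geometric laws of mean at most `m₁` and all Poisson laws. -/
def boundConst (m₁ : ℝ) : ℝ := Real.exp 1 * taylorConst m₁ + (m₁ + m₁ ^ 2) + Real.exp 4

lemma boundConst_pos {m₁ : ℝ} (h0 : 0 ≤ m₁) : 0 < boundConst m₁ := by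
  have := taylorConst_nonneg h0
  unfold boundConst; positivity

/-- When the means stay in `[m₀, m₁]` the variances are bounded above and below, so the scale can be
1 with constants independent of `ρ`. -/
lemma charFunBounds_geometric {m₀ m₁ ρ : ℝ} (h0 : 0 < m₀) (hρ0 : 0 ≤ ρ) (hρ1 : ρ < 1)
    (hm₀ : m₀ ≤ ρ / (1 - ρ)) (hm₁ : ρ / (1 - ρ) ≤ m₁) :
    CharFunBounds (decayRate m₀) (boundConst m₁) (fourierSeries (geometricMass ρ)) (ρ / (1 - ρ))
      (ρ / (1 - ρ) + (ρ / (1 - ρ)) ^ 2) 1 := by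
  have hφ : fourierSeries (geometricMass ρ) = fun t : ℝ =>
      (1 - (ρ / (1 - ρ) : ℝ) * (exp (I * t) - 1))⁻¹ :=
    funext fun t => (hasSum_geometricMass_mul hρ0 hρ1 t).tsum_eq
  rw [hφ]
  set m := ρ / (1 - ρ) with hm
  have hmpos : 0 < m := h0.trans_le hm₀
  have hm₁0 : 0 ≤ m₁ := hmpos.le.trans hm₁
  have hκ := decayRate_pos h0
  have hT := taylorConst_nonneg hm₁0
  have hD : ∀ t : ℝ, 1 ≤ ‖1 - m * (exp (I * t) - 1)‖ :=
    one_le_norm_one_sub_mul_exp_sub_one hmpos.le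
  have hD0 : ∀ t : ℝ, (1 - m * (exp (I * t) - 1) : ℂ) ≠ 0 := fun t =>
    norm_pos_iff.1 (by linarith [hD t])
  refine ⟨?_, hmpos.le, zero_le_one, ?_, ?_, fun t ht => ?_, fun t => ?_, fun t ht => ?_⟩
  · exact Continuous.inv₀ (by fun_prop) hD0
  · have := two_mul_decayRate_le h0
    nlinarith
  · have h1 : m + m ^ 2 ≤ m₁ + m₁ ^ 2 := by gcongr
    have h2 : 0 ≤ Real.exp 1 * taylorConst m₁ := by positivity
    have h3 := Real.exp_pos 4
    rw [boundConst]; linarith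
  · rw [mul_one]
    exact norm_inv_one_sub_mul_exp_sub_one_le h0 hm₀ ht
  · have h1 : (1 - m * (exp (I * t) - 1) : ℂ)⁻¹ - 1 =
        (1 - m * (exp (I * t) - 1) : ℂ)⁻¹ * (m * (exp (I * t) - 1)) := by
      have := inv_mul_cancel₀ (hD0 t)
      linear_combination this
    rw [h1, norm_mul, norm_mul, norm_inv, norm_real, Real.norm_eq_abs, abs_of_pos hmpos]
    calc _ ≤ 1 * (m * |t|) := mul_le_mul (inv_le_one_of_one_le₀ (hD t))
          (mul_le_mul_of_nonneg_left (norm_exp_I_mul_sub_one_le t) hmpos.le)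
          (by positivity) zero_le_one
      _ = _ := one_mul _
  · refine (norm_inv_sub_gaussian_le hmpos.le ht).trans ?_
    rw [mul_one, mul_one]
    have h1 := taylorConst_mono hmpos.le hm₁
    have ht2 : t ^ 2 ≤ Real.pi ^ 2 := sq_le_sq' (abs_le.1 ht).1 (abs_le.1 ht).2
    -- For `|t| ≤ π` the decay factor is at least `exp (-1)`, so it can be inserted for free; this
    -- is the `Real.exp 1` in `boundConst`.
    have h2 : Real.exp (-1) ≤ Real.exp (-(decayRate m₀ * t ^ 2)) := by
      refine Real.exp_le_exp.2 (neg_le_neg ?_)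
      exact (mul_le_mul_of_nonneg_left ht2 hκ.le).trans (decayRate_mul_pi_sq_le h0)
    have h3 : Real.exp 1 * taylorConst m₁ ≤ boundConst m₁ := by
      have := Real.exp_pos 4
      have : 0 ≤ m₁ + m₁ ^ 2 := by positivity
      rw [boundConst]; linarith
    have h4 : Real.exp 1 * Real.exp (-1) = 1 := by rw [← Real.exp_add]; simp
    calc taylorConst m * |t| ^ 3 ≤ taylorConst m₁ * |t| ^ 3 := by gcongr
      _ = Real.exp 1 * taylorConst m₁ * |t| ^ 3 * Real.exp (-1) := by
        linear_combination (-(taylorConst m₁ * |t| ^ 3)) * h4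
      _ ≤ _ := by
        have := (boundConst_pos hm₁0).le
        gcongr

/-- The exponent is proportional to `l`, so all bounds hold with scale `l`, however small or large.
The parameters `m₀` and `m₁` only make the constants agree with the geometric case. -/
lemma charFunBounds_poisson {m₀ m₁ l : ℝ} (h0 : 0 < m₀) (hm₁ : 0 ≤ m₁) (hl : 0 ≤ l) :
    CharFunBounds (decayRate m₀) (boundConst m₁) (fourierSeries (poissonMass l)) l l l := by
  have hφ : fourierSeries (poissonMass l) = fun t : ℝ => exp (l * (exp (I * t) - 1)) :=
    funext fun t => (hasSum_poissonMass_mul l t).tsum_eq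
  rw [hφ]
  have hκ := decayRate_pos h0
  have hκ1 := decayRate_le h0
  have hT := taylorConst_nonneg hm₁
  have hC : Real.exp 4 ≤ boundConst m₁ := by
    rw [boundConst]
    have : 0 ≤ Real.exp 1 * taylorConst m₁ := by positivity
    have : 0 ≤ m₁ + m₁ ^ 2 := by positivity
    linarith
  have hre : ∀ t : ℝ, (l * (exp (I * t) - 1) : ℂ).re = -(l * (1 - Real.cos t)) := by
    intro t
    rw [mul_comm I]
    simp [exp_ofReal_mul_I_re]
    ring
  have hdecay : ∀ t : ℝ, |t| ≤ Real.pi →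
      (l * (exp (I * t) - 1) : ℂ).re ≤ -(decayRate m₀ * l * t ^ 2) := by
    intro t ht
    rw [hre]
    refine neg_le_neg ?_
    have h1 := two_div_pi_sq_mul_le t ht
    have h2 : decayRate m₀ ≤ 2 / Real.pi ^ 2 := by
      rw [le_div_iff₀ (by positivity)]
      linarith [decayRate_mul_pi_sq_le h0]
    calc decayRate m₀ * l * t ^ 2 = l * (decayRate m₀ * t ^ 2) := by ring
      _ ≤ l * (2 / Real.pi ^ 2 * t ^ 2) := by gcongr
      _ ≤ _ := by gcongr
  refine ⟨by fun_prop, hl, hl, ?_, ?_, fun t ht => ?_, fun t => ?_, fun t ht => ?_⟩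
  · nlinarith
  · have : 1 ≤ boundConst m₁ := (Real.one_le_exp (by norm_num)).trans hC
    nlinarith
  · rw [norm_exp]
    exact Real.exp_le_exp.2 (hdecay t ht)
  · have h1 := norm_exp_sub_exp_le (z := l * (exp (I * t) - 1)) (w := 0) (a := 0) (by
      rw [hre]
      have := mul_nonneg hl (sub_nonneg.2 (Real.cos_le_one t))
      linarith) (by simp)
    rw [Complex.exp_zero, Real.exp_zero, one_mul, sub_zero, norm_mul, norm_real, Real.norm_eq_abs,
      abs_of_nonneg hl] at h1
    exact h1.trans (mul_le_mul_of_nonneg_left (norm_exp_I_mul_sub_one_le t) hl)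
  · have h1 := norm_exp_sub_exp_le (z := l * (exp (I * t) - 1))
      (w := I * (l * t) - l * t ^ 2 / 2) (hdecay t ht) (by
        have : (I * (l * t) - l * t ^ 2 / 2 : ℂ).re = -(l * t ^ 2 / 2) := by
          simp [← ofReal_pow]
        rw [this]
        have : 0 ≤ l * t ^ 2 := by positivity
        nlinarith)
    have h2 : (l * (exp (I * t) - 1) - (I * (l * t) - l * t ^ 2 / 2) : ℂ) =
        l * (exp (I * t) - 1 - (I * t - t ^ 2 / 2)) := by ring
    rw [h2, norm_mul, norm_real, Real.norm_eq_abs, abs_of_nonneg hl] at h1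
    refine h1.trans ?_
    rw [mul_comm (Real.exp _)]
    have h3 := norm_exp_I_mul_taylor_le ht
    refine mul_le_mul_of_nonneg_right ?_ (Real.exp_pos _).le
    calc l * _ ≤ l * (Real.exp 4 * |t| ^ 3) := by gcongr
      _ = Real.exp 4 * l * |t| ^ 3 := by ring
      _ ≤ _ := by gcongr

end NodeLaws

/-! ### Uniqueness of solutions of the balance equations, and the product form. -/

section ProductForm

/-- On a finite irreducible state space, a solution of the balance equations is a multiple of any
positive one. -/
lemma exists_eq_mul_of_balance {X : Type*} (S : Finset X) (hS : S.Nonempty) (q : X → X → ℝ)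
    (hq : ∀ a b, 0 ≤ q a b) (π W : X → ℝ)
    (hπ : ∀ m ∈ S, ∑ n ∈ S, π n * q n m = π m * ∑ n ∈ S, q m n)
    (hW : ∀ m ∈ S, ∑ n ∈ S, W n * q n m = W m * ∑ n ∈ S, q m n)
    (hWpos : ∀ n ∈ S, 0 < W n)
    (hconn : ∀ n ∈ S, ∀ m ∈ S, Relation.ReflTransGen (fun a b => a ∈ S ∧ 0 < q a b) n m) :
    ∃ c : ℝ, ∀ n ∈ S, π n = c * W n := by
  -- Minimum principle: subtracting the smallest ratio times `W` leaves a nonnegative solution that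
  -- vanishes at `m₀`.
  obtain ⟨m₀, hm₀, hmin⟩ := S.exists_min_image (fun n => π n / W n) hS
  set c := π m₀ / W m₀
  have hnonneg : ∀ n ∈ S, 0 ≤ π n - c * W n := by
    intro n hn
    have := (le_div_iff₀ (hWpos n hn)).1 (hmin n hn)
    linarith
  have hzero : π m₀ - c * W m₀ = 0 := by
    rw [div_mul_cancel₀ _ (hWpos m₀ hm₀).ne', sub_self]
  have hbal : ∀ m ∈ S, ∑ n ∈ S, (π n - c * W n) * q n m = (π m - c * W m) * ∑ n ∈ S, q m n := by
    intro m hm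
    simp_rw [sub_mul, Finset.sum_sub_distrib, mul_assoc, ← Finset.mul_sum]
    rw [hπ m hm, hW m hm]
  refine ⟨c, fun n hn => ?_⟩
  suffices h : π n - c * W n = 0 by linarith
  induction hconn n hn m₀ hm₀ using Relation.ReflTransGen.head_induction_on with
  | refl => exact hzero
  | head hab hrest ih =>
    rename_i a b
    by_cases hb : b ∈ S
    · have h1 := hbal b hb
      rw [ih hb, zero_mul, Finset.sum_eq_zero_iff_of_nonneg
        (fun n hn => mul_nonneg (hnonneg n hn) (hq n b))] at h1
      exact (mul_eq_zero.1 (h1 a hab.1)).resolve_right hab.2.ne'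
    · rcases hrest.cases_head with h | ⟨_, h, _⟩
      · exact absurd (h ▸ hm₀) hb
      · exact absurd h.1 hb

variable {V : Type*} [DecidableEq V]

lemma sub_single_add_single {n : V → ℕ} {i : V} (h : 0 < n i) :
    n - Pi.single i 1 + Pi.single i 1 = n := by
  refine tsub_add_cancel_of_le fun k => ?_
  by_cases hk : k = i
  · subst hk; simpa using Nat.succ_le_of_lt h
  · simp [hk]

lemma exists_eq_add_single {n : V → ℕ} {i : V} (h : 0 < n i) :
    ∃ n' : V → ℕ, n = n' + Pi.single i 1 :=
  ⟨_, (sub_single_add_single h).symm⟩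

variable [Fintype V]

lemma mem_configurations {M : ℕ} {n : V → ℕ} : n ∈ configurations V M ↔ ∑ i, n i = M := by
  simp [configurations]

lemma add_single_mem_configurations {M : ℕ} {n : V → ℕ} (i j : V)
    (h : n + Pi.single i 1 ∈ configurations V M) : n + Pi.single j 1 ∈ configurations V M := by
  rw [mem_configurations] at h ⊢
  simp only [Pi.add_apply, Finset.sum_add_distrib, Finset.sum_pi_single', Finset.mem_univ,
    if_true] at h ⊢
  exact h

section Connectivity

variable {g : V → ℕ → ℝ} {P : Matrix V V ℝ}

lemma jumpRate_nonneg (hg : ∀ i k, 0 ≤ g i k) (hP : ∀ i j, 0 ≤ P i j)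
    (n m : V → ℕ) : 0 ≤ jumpRate g P n m := by
  refine Finset.sum_nonneg fun i _ => Finset.sum_nonneg fun j _ => ?_
  split_ifs
  · exact mul_nonneg (hg _ _) (hP _ _)
  · exact le_rfl

lemma jumpRate_pos (hg : ∀ i k, 0 ≤ g i k) (hg1 : ∀ i k, 0 < k → 0 < g i k)
    (hP : ∀ i j, 0 ≤ P i j) (n : V → ℕ) {i j : V} (hij : 0 < P i j) :
    0 < jumpRate g P (n + Pi.single i 1) (n + Pi.single j 1) := by
  have h0 : ∀ i' j' : V, 0 ≤ if n + Pi.single j 1 = (n + Pi.single i 1) - Pi.single i' 1 +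
      Pi.single j' 1 then g i' ((n + Pi.single i 1 : V → ℕ) i') * P i' j' else 0 := by
    intro i' j'
    split_ifs
    · exact mul_nonneg (hg _ _) (hP _ _)
    · exact le_rfl
  refine lt_of_lt_of_le ?_ ((Finset.single_le_sum (fun j' _ => h0 i j') (Finset.mem_univ j)).trans
    (Finset.single_le_sum (f := fun i' => ∑ j', _)
      (fun i' _ => Finset.sum_nonneg fun j' _ => h0 i' j') (Finset.mem_univ i)))
  rw [if_pos (by rw [add_tsub_cancel_right])]
  exact mul_pos (hg1 _ _ (by simp)) hij

lemma reflTransGen_jumpRate_of_path (hg : ∀ i k, 0 ≤ g i k) (hg1 : ∀ i k, 0 < k → 0 < g i k)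
    (hP : ∀ i j, 0 ≤ P i j) {M : ℕ} {i j : V}
    (hij : Relation.ReflTransGen (fun a b => 0 < P a b) i j) (n : V → ℕ)
    (hn : n + Pi.single i 1 ∈ configurations V M) :
    Relation.ReflTransGen (fun a b => a ∈ configurations V M ∧ 0 < jumpRate g P a b)
      (n + Pi.single i 1) (n + Pi.single j 1) := by
  induction hij using Relation.ReflTransGen.head_induction_on with
  | refl => exact .refl
  | head hab _ ih =>
    exact .head ⟨hn, jumpRate_pos hg hg1 hP n hab⟩ (ih (add_single_mem_configurations _ _ hn))

/-- Induction on the total excess of `n` over `m`, a sum of truncated differences: carrying one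
customer from an overfull to an underfull node along a routing path decreases it. -/
lemma reflTransGen_jumpRate (hg : ∀ i k, 0 ≤ g i k) (hg1 : ∀ i k, 0 < k → 0 < g i k)
    (hP : ∀ i j, 0 ≤ P i j) {M : ℕ}
    (hconn : ∀ i j, Relation.ReflTransGen (fun a b => 0 < P a b) i j) (n m : V → ℕ)
    (hn : n ∈ configurations V M) (hm : m ∈ configurations V M) :
    Relation.ReflTransGen (fun a b => a ∈ configurations V M ∧ 0 < jumpRate g P a b) n m := by
  induction hd : ∑ i, (n i - m i) using Nat.strong_induction_on generalizing n with
  | _ d ih =>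
    have hn' := mem_configurations.1 hn
    have hm' := mem_configurations.1 hm
    by_cases hnm : n = m
    · rw [hnm]
    · obtain ⟨i, hi⟩ : ∃ i, m i < n i := by
        by_contra! h
        exact hnm (funext fun i => (Finset.sum_eq_sum_iff_of_le fun i _ => h i).1
          (hn'.trans hm'.symm) i (Finset.mem_univ i))
      obtain ⟨j, hj⟩ : ∃ j, n j < m j := by
        by_contra! h
        exact hnm (funext fun i => ((Finset.sum_eq_sum_iff_of_le fun i _ => h i).1
          (hm'.trans hn'.symm) i (Finset.mem_univ i)).symm)
      obtain ⟨n', rfl⟩ := exists_eq_add_single (n := n) (i := i) (by omega)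
      have hij : j ≠ i := by rintro rfl; omega
      refine (reflTransGen_jumpRate_of_path hg hg1 hP (hconn i j) n' hn).trans
        (ih _ ?_ _ (add_single_mem_configurations _ _ hn) rfl)
      rw [← hd]
      refine Finset.sum_lt_sum (fun k _ => ?_) ⟨i, Finset.mem_univ i, ?_⟩
      · by_cases hk : k = j
        · subst hk
          simp [hij] at hj ⊢
          omega
        · simp [hk]
          omega
      · simp [hij.symm] at hi ⊢
        omega

end Connectivity

section Balance

variable {g : V → ℕ → ℝ} {P : Matrix V V ℝ} {α : V → ℝ} {w : V → ℕ → ℝ}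

lemma prod_add_single_mul (hw : ∀ i k, w i (k + 1) * g i (k + 1) = α i * w i k) (n : V → ℕ)
    (i : V) :
    (∏ b, w b ((n + Pi.single i 1 : V → ℕ) b)) * g i ((n + Pi.single i 1 : V → ℕ) i) = α i * ∏ b, w b (n b) := by
  rw [← Finset.mul_prod_erase _ _ (Finset.mem_univ i),
    ← Finset.mul_prod_erase Finset.univ (fun b => w b (n b)) (Finset.mem_univ i)]
  have h : ∏ b ∈ Finset.univ.erase i, w b ((n + Pi.single i 1 : V → ℕ) b) =
      ∏ b ∈ Finset.univ.erase i, w b (n b) := by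
    refine Finset.prod_congr rfl fun b hb => ?_
    simp [Finset.ne_of_mem_erase hb]
  rw [h]
  have := hw i (n i)
  simp only [Pi.add_apply, Pi.single_eq_same]
  linear_combination (∏ b ∈ Finset.univ.erase i, w b (n b)) * this

lemma sum_jumpRate (hg0 : ∀ i, g i 0 = 0) (hP1 : ∀ i, ∑ j, P i j = 1) {M : ℕ} {m : V → ℕ}
    (hm : m ∈ configurations V M) :
    ∑ n ∈ configurations V M, jumpRate g P m n = ∑ i, g i (m i) := by
  unfold jumpRate
  rw [Finset.sum_comm]
  refine Finset.sum_congr rfl fun i _ => ?_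
  rw [Finset.sum_comm]
  calc _ = ∑ j, g i (m i) * P i j := by
        refine Finset.sum_congr rfl fun j _ => ?_
        rcases Nat.eq_zero_or_pos (m i) with h | h
        · simp [h, hg0]
        · obtain ⟨m', rfl⟩ := exists_eq_add_single h
          rw [Finset.sum_ite_eq', if_pos]
          rw [add_tsub_cancel_right]
          exact add_single_mem_configurations _ _ hm
    _ = _ := by rw [← Finset.mul_sum, hP1, mul_one]

lemma sum_prod_mul_ite (hg0 : ∀ i, g i 0 = 0)
    (hw : ∀ i k, w i (k + 1) * g i (k + 1) = α i * w i k) {M : ℕ} {m : V → ℕ}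
    (hm : m ∈ configurations V M) (i j : V) :
    ∑ n ∈ configurations V M,
      (if m = n - Pi.single i 1 + Pi.single j 1 then (∏ b, w b (n b)) * g i (n i) else 0) =
      if 0 < m j then α i * ∏ b, w b ((m - Pi.single j 1 : V → ℕ) b) else 0 := by
  split_ifs with h
  · obtain ⟨m', rfl⟩ := exists_eq_add_single h
    rw [add_tsub_cancel_right, Finset.sum_eq_single (m' + Pi.single i 1)]
    · rw [if_pos (by rw [add_tsub_cancel_right])]
      exact prod_add_single_mul hw m' i
    · intro n _ hne
      -- Truncated subtraction could produce spurious predecessors with `n i = 0`; their departure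
      -- rate vanishes.
      rcases Nat.eq_zero_or_pos (n i) with h0 | h0
      · simp [h0, hg0]
      · obtain ⟨n', rfl⟩ := exists_eq_add_single h0
        rw [if_neg]
        rw [add_tsub_cancel_right]
        exact fun h1 => hne (by rw [add_right_cancel h1])
    · intro h1
      exact absurd (add_single_mem_configurations _ _ hm) h1
  · refine Finset.sum_eq_zero fun n _ => if_neg fun h1 => h ?_
    rw [h1]
    simp

/-- The product form solves the global balance equations. -/
lemma product_form_balance (hg0 : ∀ i, g i 0 = 0)
    (hP1 : ∀ i, ∑ j, P i j = 1) (hα : ∀ j, ∑ i, α i * P i j = α j)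
    (hw : ∀ i k, w i (k + 1) * g i (k + 1) = α i * w i k) {M : ℕ} {m : V → ℕ}
    (hm : m ∈ configurations V M) :
    ∑ n ∈ configurations V M, (∏ b, w b (n b)) * jumpRate g P n m =
      (∏ b, w b (m b)) * ∑ n ∈ configurations V M, jumpRate g P m n := by
  rw [sum_jumpRate hg0 hP1 hm]
  unfold jumpRate
  simp_rw [Finset.mul_sum]
  rw [Finset.sum_comm]
  simp_rw [Finset.sum_comm (s := configurations V M)]
  rw [Finset.sum_comm]
  -- Partial balance: the flow into `m` by an arrival at `j` equals the flow out of `m` by a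
  -- departure from `j`, for each `j` separately.
  refine Finset.sum_congr rfl fun j _ => ?_
  calc _ = ∑ i, (if 0 < m j then α i * ∏ b, w b ((m - Pi.single j 1 : V → ℕ) b) else 0) * P i j := by
        refine Finset.sum_congr rfl fun i _ => ?_
        rw [← sum_prod_mul_ite hg0 hw hm i j, Finset.sum_mul]
        refine Finset.sum_congr rfl fun n _ => ?_
        split_ifs <;> ring
    _ = _ := by
        rcases Nat.eq_zero_or_pos (m j) with h | h
        · simp [h, hg0]
        · simp_rw [if_pos h]
          obtain ⟨m', rfl⟩ := exists_eq_add_single h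
          rw [add_tsub_cancel_right, prod_add_single_mul hw, ← hα j, Finset.sum_mul]
          exact Finset.sum_congr rfl fun i _ => by ring

/-- The stationary law of a closed Jackson network has product form. -/
theorem IsStationaryLaw.mul_sum_eq_prod {M : ℕ} {π : (V → ℕ) → ℝ} (hπ : IsStationaryLaw g P M π)
    (hg0 : ∀ i, g i 0 = 0) (hg1 : ∀ i k, 0 < k → 0 < g i k) (hP : ∀ i j, 0 ≤ P i j)
    (hP1 : ∀ i, ∑ j, P i j = 1) (hconn : ∀ i j, Relation.ReflTransGen (fun a b => 0 < P a b) i j)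
    (hα : ∀ j, ∑ i, α i * P i j = α j)
    (hw : ∀ i k, w i (k + 1) * g i (k + 1) = α i * w i k) (hw0 : ∀ i k, 0 < w i k)
    {n : V → ℕ} (hn : n ∈ configurations V M) :
    π n * ∑ f ∈ configurations V M, ∏ b, w b (f b) = ∏ b, w b (n b) := by
  have hg : ∀ i k, 0 ≤ g i k := by
    intro i k
    rcases Nat.eq_zero_or_pos k with rfl | h
    · exact (hg0 i).ge
    · exact (hg1 i k h).le
  obtain ⟨c, hc⟩ := exists_eq_mul_of_balance (configurations V M) ⟨n, hn⟩ (jumpRate g P)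
    (jumpRate_nonneg hg hP) π (fun n => ∏ b, w b (n b)) hπ.balance
    (fun m hm => product_form_balance hg0 hP1 hα hw hm)
    (fun n _ => Finset.prod_pos fun b _ => hw0 b _)
    (fun n hn m hm => reflTransGen_jumpRate hg hg1 hP hconn n m hn hm)
  have h1 := hπ.sum_eq_one
  rw [Finset.sum_congr rfl hc, ← Finset.mul_sum] at h1
  rw [hc n hn, mul_right_comm, h1, one_mul]

/-- The marginals of a product form. -/
lemma marginal_mul_sum_eq {M : ℕ} {π : (V → ℕ) → ℝ}
    (hπ : ∀ n ∈ configurations V M,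
      π n * ∑ f ∈ configurations V M, ∏ b, w b (f b) = ∏ b, w b (n b))
    {K : ℕ} {e : Fin K → V} (he : Function.Injective e) (x : Fin K → ℕ) :
    marginal M π e x * ∑ f ∈ configurations V M, ∏ b, w b (f b) =
      (∏ k, w (e k) (x k)) * ∑ f ∈ configurations V M,
        ∏ b, if b ∈ Finset.univ.image e then (if f b = Function.extend e x 0 b then 1 else 0)
          else w b (f b) := by
  unfold marginal
  rw [Finset.sum_mul, Finset.mul_sum, Finset.sum_filter]
  refine Finset.sum_congr rfl fun n hn => ?_
  rw [hπ n hn, ← Finset.prod_mul_prod_compl (Finset.univ.image e) (fun b => w b (n b)),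
    ← Finset.prod_mul_prod_compl (Finset.univ.image e) (fun b => if b ∈ Finset.univ.image e then _
      else _),
    Finset.prod_image he.injOn, Finset.prod_image he.injOn]
  have h1 : ∏ b ∈ (Finset.univ.image e)ᶜ, (if b ∈ Finset.univ.image e then
      (if n b = Function.extend e x 0 b then (1 : ℝ) else 0) else w b (n b)) =
      ∏ b ∈ (Finset.univ.image e)ᶜ, w b (n b) :=
    Finset.prod_congr rfl fun b hb => if_neg (Finset.mem_compl.1 hb)
  have h2 : ∏ k, (if e k ∈ Finset.univ.image e then
      (if n (e k) = Function.extend e x 0 (e k) then (1 : ℝ) else 0) else w (e k) (n (e k))) =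
      if ∀ k, n (e k) = x k then 1 else 0 := by
    simp_rw [he.extend_apply, if_pos (Finset.mem_image_of_mem e (Finset.mem_univ _))]
    rw [Finset.prod_ite_zero]
    simp
  rw [h1, h2]
  split_ifs with h
  · simp [h]
  · simp

end Balance

end ProductForm

/-! ### Quantitative independence under a product form. -/

section MarginalEstimate

open Complex

variable {V : Type*} [Fintype V] [DecidableEq V]

lemma hasSum_single_mul_exp (y : ℕ) (t : ℝ) :
    HasSum (fun k : ℕ => ((if k = y then 1 else 0 : ℝ) : ℂ) * exp (I * (k * t)))
      (exp (I * (y * t))) := by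
  convert hasSum_single (f := fun k : ℕ =>
    ((if k = y then 1 else 0 : ℝ) : ℂ) * exp (I * (k * t))) y ?_ using 1
  · simp
  · intro k hk
    simp [hk]

/-- A quantitative form of the asymptotic independence of the nodes under a product form law. -/
theorem abs_marginal_sub_prod_le {κ C : ℝ} (hκ : 0 < κ) (hC : 0 ≤ C) {w : V → ℕ → ℝ}
    {m v s : V → ℝ} (hw0 : ∀ b k, 0 < w b k) (hws : ∀ b, Summable (w b))
    (h : ∀ b, CharFunBounds κ C (fourierSeries (w b)) (m b) (v b) (s b)) {M : ℕ}
    (hM : |(M : ℝ) - ∑ b, m b| ≤ 1) {π : (V → ℕ) → ℝ}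
    (hπ : ∀ n ∈ configurations V M,
      π n * ∑ f ∈ configurations V M, ∏ b, w b (f b) = ∏ b, w b (n b))
    {K : ℕ} {e : Fin K → V} (he : Function.Injective e) (x : Fin K → ℕ) {S : ℝ}
    (hSdef : S = ∑ b, s b) (hS : 1 ≤ S) (hA : ∑ k, s (e k) ≤ S / 2)
    (hlarge : (1 + 2 * C / κ) / (κ / 2) ≤ Real.exp (-(C / 2)) * √S) :
    |marginal M π e x - ∏ k, w (e k) (x k)| ≤
      2 / (κ * Real.exp (-(C / 2))) * (∑ k, (x k + m (e k))) / √S * ∏ k, w (e k) (x k) := by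
  set A := Finset.univ.image e with hAdef
  set y : V → ℕ := Function.extend e x 0 with hy
  set p : V → ℕ → ℝ := fun b k => if b ∈ A then (if k = y b then 1 else 0) else w b k with hp
  set D := ∑ f ∈ configurations V M, ∏ b, w b (f b) with hD
  set N := ∑ f ∈ configurations V M, ∏ b, p b (f b) with hN
  set T := ∑ k, ((x k : ℝ) + m (e k)) with hT
  have hS0 : 0 < S := by linarith
  have hsq : 0 < √S := Real.sqrt_pos.2 hS0
  have hpsum : ∀ b, Summable (p b) := by
    intro b
    by_cases hb : b ∈ A
    · simp only [hp, if_pos hb]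
      exact (hasSum_ite_eq (y b) (1 : ℝ)).summable
    · simp only [hp, if_neg hb]
      exact hws b
  have hp0 : ∀ b k, 0 ≤ p b k := by
    intro b k
    simp only [hp]
    split_ifs
    exacts [zero_le_one, le_rfl, (hw0 b k).le]
  have hpφ : ∀ b, fourierSeries (p b) =
      fun t : ℝ => if b ∈ A then exp (I * (y b * t)) else fourierSeries (w b) t := by
    intro b
    ext t
    by_cases hb : b ∈ A
    · simp only [hp, if_pos hb]
      exact (hasSum_single_mul_exp (y b) t).tsum_eq
    · simp only [hp, if_neg hb]
  have hsumA : ∀ f : V → ℝ, ∑ b ∈ A, f b = ∑ k, f (e k) := fun f => Finset.sum_image he.injOn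
  have hTA : ∑ b ∈ A, ((y b : ℝ) + m b) = T := by
    rw [hsumA]
    simp_rw [hy, he.extend_apply, hT]
  have hcompl : S / 2 ≤ ∑ b ∈ Aᶜ, s b := by
    have := Finset.sum_add_sum_compl A s
    rw [hsumA s, ← hSdef] at this
    linarith
  have hT0 : 0 ≤ T :=
    Finset.sum_nonneg fun k _ => add_nonneg (Nat.cast_nonneg _) (h (e k)).mean_nonneg
  have hID := integral_prod_fourierSeries w hws (fun b k => (hw0 b k).le) M
  have hIN := integral_prod_fourierSeries p hpsum hp0 M
  rw [← hD] at hID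
  rw [← hN] at hIN
  have hD0 : 0 ≤ D := Finset.sum_nonneg fun f _ => Finset.prod_nonneg fun b _ => (hw0 b _).le
  have hpi : 0 < 2 * Real.pi := by positivity
  have hdiff : 2 * Real.pi * |N - D| ≤ T / (κ * (S / 2)) := by
    have h1 := norm_integral_prod_sub_prod_le hκ h A y (by linarith) M
    simp_rw [hpφ] at hIN
    push_cast at h1
    rw [hIN, hID, hTA, ← mul_sub, ← ofReal_sub, norm_mul, norm_real] at h1
    have h2 : ‖(2 * Real.pi : ℂ)‖ = 2 * Real.pi := by
      simp [abs_of_pos Real.pi_pos]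
    rw [h2, Real.norm_eq_abs] at h1
    refine h1.trans ?_
    gcongr
  -- The hypothesis `hlarge` makes the Gaussian approximation error at most half of the main term.
  have hlow : Real.exp (-(C / 2)) / √S ≤ 2 * Real.pi * D := by
    have h1 := le_norm_integral_prod hκ hC h (by linarith) hM
    push_cast at h1
    rw [hID, ← hSdef, norm_mul, norm_real, Real.norm_eq_abs, abs_of_nonneg hD0] at h1
    have h2 : ‖(2 * Real.pi : ℂ)‖ = 2 * Real.pi := by
      simp [abs_of_pos Real.pi_pos]
    rw [h2] at h1
    refine le_trans ?_ h1
    have h3 : (1 + 2 * C / κ) / (κ / 2 * S) ≤ Real.exp (-(C / 2)) / √S := by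
      rw [← div_div, div_le_div_iff₀ hS0 hsq]
      calc _ ≤ Real.exp (-(C / 2)) * √S * √S := by gcongr
        _ = _ := by rw [mul_assoc, Real.mul_self_sqrt hS0.le]
    have h4 : 2 * Real.exp (-(C / 2)) / √S =
        Real.exp (-(C / 2)) / √S + Real.exp (-(C / 2)) / √S := by ring
    linarith
  have hDpos : 0 < D := by
    have : 0 < Real.exp (-(C / 2)) / √S := by positivity
    exact pos_of_mul_pos_right (this.trans_le hlow) hpi.le
  have hmarg : marginal M π e x * D = (∏ k, w (e k) (x k)) * N := marginal_mul_sum_eq hπ he x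
  have hprod : 0 ≤ ∏ k, w (e k) (x k) := Finset.prod_nonneg fun k _ => (hw0 _ _).le
  have hND : |N - D| ≤ 2 / (κ * Real.exp (-(C / 2))) * T / √S * D := by
    have h1 : T / (κ * (S / 2)) =
        2 / (κ * Real.exp (-(C / 2))) * T / √S * (Real.exp (-(C / 2)) / √S) := by
      have h2 : S = √S * √S := (Real.mul_self_sqrt hS0.le).symm
      nth_rewrite 1 [h2]
      field_simp
    have h3 : 2 * Real.pi * |N - D| ≤
        2 * Real.pi * (2 / (κ * Real.exp (-(C / 2))) * T / √S * D) := by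
      refine hdiff.trans ?_
      rw [h1]
      calc _ ≤ 2 / (κ * Real.exp (-(C / 2))) * T / √S * (2 * Real.pi * D) := by gcongr
        _ = _ := by ring
    exact le_of_mul_le_mul_left h3 hpi
  have hfin : (marginal M π e x - ∏ k, w (e k) (x k)) * D = (∏ k, w (e k) (x k)) * (N - D) := by
    rw [sub_mul, hmarg]; ring
  refine le_of_mul_le_mul_right ?_ hDpos
  rw [← abs_of_pos hDpos, ← abs_mul, abs_of_pos hDpos, hfin, abs_mul, abs_of_nonneg hprod]
  calc _ ≤ (∏ k, w (e k) (x k)) * (2 / (κ * Real.exp (-(C / 2))) * T / √S * D) := by gcongr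
    _ = _ := by ring

end MarginalEstimate

/-! ### The bike-sharing network as a Jackson network, and the estimate for a single network. -/

namespace Network

variable (net : Network)

lemma routing_nonneg (a b : Node net.q) : 0 ≤ net.routing a b := by
  rcases a with i | r <;> rcases b with j | r'
  · exact le_rfl
  · change 0 ≤ if r'.1.1 = i then net.q r'.1.1 r'.1.2 else 0
    split_ifs
    exacts [r'.2.le, le_rfl]
  · change (0 : ℝ) ≤ if r.1.2 = j then 1 else 0
    split_ifs
    exacts [zero_le_one, le_rfl]
  · exact le_rfl

lemma sum_route (f : Fin net.J → Fin net.J → ℝ) (hf : ∀ i j, net.q i j = 0 → f i j = 0) :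
    ∑ r : Route net.q, f r.1.1 r.1.2 = ∑ i, ∑ j, f i j := by
  rw [← Fintype.sum_prod_type' f,
    ← Finset.sum_subtype (Finset.univ.filter fun p : Fin net.J × Fin net.J => 0 < net.q p.1 p.2)
      (by simp) (fun p => f p.1 p.2)]
  refine Finset.sum_filter_of_ne fun p _ hp => ?_
  exact lt_of_le_of_ne (net.irreducible.nonneg _ _) fun h => hp (hf _ _ h.symm)

lemma routing_row_sum (a : Node net.q) : ∑ b, net.routing a b = 1 := by
  rw [Fintype.sum_sum_type]
  rcases a with i | r
  · have h1 : ∀ j, net.routing (.inl i) (.inl j) = 0 := fun _ => rfl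
    have h2 : ∀ r, net.routing (.inl i) (.inr r) =
      if r.1.1 = i then net.q r.1.1 r.1.2 else 0 := fun _ => rfl
    simp_rw [h1, h2]
    rw [net.sum_route (fun a b => if a = i then net.q a b else 0)
      (fun a b h => by simp [h])]
    rw [Finset.sum_comm]
    simp [net.row_sum]
  · have h1 : ∀ j, net.routing (.inr r) (.inl j) = if r.1.2 = j then 1 else 0 := fun _ => rfl
    have h2 : ∀ r', net.routing (.inr r) (.inr r') = 0 := fun _ => rfl
    simp [h1, h2]

lemma routing_connected (a b : Node net.q) :
    Relation.ReflTransGen (fun a b => 0 < net.routing a b) a b := by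
  have hin : ∀ r : Route net.q, 0 < net.routing (.inl r.1.1) (.inr r) := by
    intro r
    change 0 < if r.1.1 = r.1.1 then net.q r.1.1 r.1.2 else 0
    rw [if_pos rfl]
    exact r.2
  have hout : ∀ r : Route net.q, 0 < net.routing (.inr r) (.inl r.1.2) := by
    intro r
    change (0 : ℝ) < if r.1.2 = r.1.2 then 1 else 0
    rw [if_pos rfl]
    exact one_pos
  have hst : ∀ i j : Fin net.J,
      Relation.ReflTransGen (fun a b => 0 < net.routing a b) (.inl i) (.inl j) := by
    intro i j
    let : Quiver (Fin net.J) := net.q.toQuiver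
    obtain ⟨path, -⟩ := net.irreducible.connected i j
    induction path with
    | nil => exact .refl
    | cons _ hom ih =>
      -- An edge of the station graph becomes two routing steps, through the corresponding route.
      let r : Route net.q := ⟨(_, _), hom.down⟩
      exact (ih.tail (hin r)).tail (hout r)
  have hfrom : ∀ (a : Node net.q) (j : Fin net.J),
      Relation.ReflTransGen (fun a b => 0 < net.routing a b) a (.inl j) := by
    intro a j
    rcases a with i | r
    · exact hst i j
    · exact .head (hout r) (hst _ j)
  rcases b with j | r
  · exact hfrom a j
  · exact (hfrom a _).tail (hin r)

lemma departureRate_zero (a : Node net.q) : net.departureRate a 0 = 0 := by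
  rcases a with i | r
  · change (if (0 : ℕ) = 0 then 0 else net.μ (.inl i)) = 0
    rw [if_pos rfl]
  · change net.μ (.inr r) * ((0 : ℕ) : ℝ) = 0
    simp

lemma departureRate_pos (a : Node net.q) (k : ℕ) (hk : 0 < k) : 0 < net.departureRate a k := by
  rcases a with i | r
  · change 0 < if k = 0 then 0 else net.μ (.inl i)
    rw [if_neg hk.ne']
    exact net.μ_pos _
  · exact mul_pos (net.μ_pos _) (Nat.cast_pos.2 hk)

variable {ν : Fin net.J → ℝ}

/-- The throughputs are `γ ν_i / 2` at stations and `γ ν_i q_ij / 2` at routes, so the equation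
reduces to the invariance of `ν`. The factor `γ` stays free. -/
lemma traffic_equation (hν : IsInvariantDistribution net.q ν) (γ : ℝ) (b : Node net.q) :
    ∑ a, net.μ a * (γ * net.utilization ν a) * net.routing a b =
      net.μ b * (γ * net.utilization ν b) := by
  have hl : ∀ i, net.μ (.inl i) * (γ * net.utilization ν (.inl i)) = γ * (ν i / 2) := by
    intro i
    have := (net.μ_pos (.inl i)).ne'
    change net.μ (.inl i) * (γ * (ν i / (2 * net.μ (.inl i)))) = _
    field_simp
  have hr : ∀ r, net.μ (.inr r) * (γ * net.utilization ν (.inr r)) =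
      γ * (ν r.1.1 * net.q r.1.1 r.1.2 / 2) := by
    intro r
    have := (net.μ_pos (.inr r)).ne'
    change net.μ (.inr r) * (γ * (ν r.1.1 * net.q r.1.1 r.1.2 / (2 * net.μ (.inr r)))) = _
    field_simp
  rw [Fintype.sum_sum_type]
  rcases b with j | r
  · have h1 : ∀ i, net.routing (.inl i) (.inl j) = 0 := fun _ => rfl
    have h2 : ∀ r, net.routing (.inr r) (.inl j) = if r.1.2 = j then 1 else 0 := fun _ => rfl
    simp_rw [h1, h2, hl, hr]
    rw [net.sum_route (fun a b => γ * (ν a * net.q a b / 2) * if b = j then 1 else 0)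
      (fun a b h => by simp [h])]
    simp only [mul_zero, Finset.sum_const_zero, zero_add, mul_ite, mul_one,
      Finset.sum_ite_eq', Finset.mem_univ, if_true]
    rw [← Finset.mul_sum, ← Finset.sum_div, hν.invariant]
  · have h1 : ∀ i, net.routing (.inl i) (.inr r) =
      if r.1.1 = i then net.q r.1.1 r.1.2 else 0 := fun _ => rfl
    have h2 : ∀ r', net.routing (.inr r') (.inr r) = 0 := fun _ => rfl
    simp_rw [h1, h2, hl, hr]
    simp
    ring

/-- The one-node recursion that makes the approximating masses admissible product-form weights:
single-server nodes give geometric laws, infinite-server nodes Poisson laws. -/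
lemma approxMass_succ_mul (δ : ℝ) (a : Node net.q) (k : ℕ) :
    net.approxMass ν δ a (k + 1) * net.departureRate a (k + 1) =
      net.μ a * (net.gammaFactor ν δ * net.utilization ν a) * net.approxMass ν δ a k := by
  rcases a with i | r
  · change geometricMass _ (k + 1) * (if k + 1 = 0 then 0 else net.μ (.inl i)) =
      _ * geometricMass _ k
    rw [if_neg (Nat.succ_ne_zero k), geometricMass, geometricMass]
    ring
  · change poissonMass _ (k + 1) * (net.μ (.inr r) * ((k + 1 : ℕ) : ℝ)) = _ * poissonMass _ k
    have h1 : (k.factorial : ℝ) ≠ 0 := by exact_mod_cast k.factorial_ne_zero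
    have h2 : (k : ℝ) + 1 ≠ 0 := by positivity
    rw [poissonMass, poissonMass, Nat.factorial_succ]
    push_cast
    field_simp
    ring

lemma utilization_nonneg (hν : IsInvariantDistribution net.q ν) (a : Node net.q) :
    0 ≤ net.utilization ν a := by
  rcases a with i | r
  · exact div_nonneg (hν.nonneg i) (by linarith [net.μ_pos (.inl i)])
  · exact div_nonneg (mul_nonneg (hν.nonneg _) r.2.le) (by linarith [net.μ_pos (.inr r)])

lemma maxStation_nonneg (hν : IsInvariantDistribution net.q ν) : 0 ≤ net.maxStation ν :=
  Real.iSup_nonneg fun _ => net.utilization_nonneg hν _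

lemma minStation_nonneg (hν : IsInvariantDistribution net.q ν) : 0 ≤ net.minStation ν :=
  Real.iInf_nonneg fun _ => net.utilization_nonneg hν _

lemma maxRoute_nonneg (hν : IsInvariantDistribution net.q ν) : 0 ≤ net.maxRoute ν :=
  Real.iSup_nonneg fun _ => net.utilization_nonneg hν _

lemma utilization_le_maxStation (j : Fin net.J) :
    net.utilization ν (.inl j) ≤ net.maxStation ν :=
  le_ciSup (f := fun j => net.utilization ν (.inl j)) (Set.finite_range _).bddAbove j

lemma minStation_le_utilization (j : Fin net.J) :
    net.minStation ν ≤ net.utilization ν (.inl j) :=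
  ciInf_le (f := fun j => net.utilization ν (.inl j)) (Set.finite_range _).bddBelow j

lemma utilization_le_maxRoute (r : Route net.q) :
    net.utilization ν (.inr r) ≤ net.maxRoute ν :=
  le_ciSup (f := fun r => net.utilization ν (.inr r)) (Set.finite_range _).bddAbove r

lemma numNodes_le : net.numNodes ≤ net.J + net.J * net.J := by
  unfold numNodes
  rw [Fintype.card_sum, Fintype.card_fin]
  have : Fintype.card (Route net.q) ≤ Fintype.card (Fin net.J × Fin net.J) :=
    Fintype.card_le_of_injective Subtype.val Subtype.val_injective
  rw [Fintype.card_prod, Fintype.card_fin] at this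
  omega

/-- The mean of the approximating distribution at a node with parameter `ρ`. -/
def approxMean (ρ : ℝ) : Node net.q → ℝ
  | .inl _ => ρ / (1 - ρ)
  | .inr _ => ρ

/-- The variance of the approximating distribution at a node with parameter `ρ`. -/
def approxVar (ρ : ℝ) : Node net.q → ℝ
  | .inl _ => ρ / (1 - ρ) + (ρ / (1 - ρ)) ^ 2
  | .inr _ => ρ

/-- The order of magnitude of the variance at a node with parameter `ρ`. -/
def approxScale (ρ : ℝ) : Node net.q → ℝ
  | .inl _ => 1
  | .inr _ => ρ

/-- The estimate of the marginals for a single network. -/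
theorem abs_marginal_sub_prod_approxMass_le (hν : IsInvariantDistribution net.q ν) {δ c : ℝ}
    (hδ0 : 0 < δ) (hδ1 : δ < 1) (hc : 0 < c) (hcomp : c ≤ net.minStation ν / net.maxStation ν)
    {M : ℕ} (hM : |(M : ℝ) - net.totalMean ν δ| < 1) {π : (Node net.q → ℕ) → ℝ}
    (hπ : net.IsStationary M π) {κ C m₁ : ℝ} (hκ : κ = decayRate ((1 - δ) * c))
    (hm₁ : m₁ = (1 - δ) / δ) (hC : C = boundConst m₁) {K : ℕ} {e : Fin K → Node net.q}
    (he : Function.Injective e) (x : Fin K → ℕ) {η : ℝ} (hη0 : 0 ≤ η)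
    (hη : ∀ k r, e k = .inr r →
      net.utilization ν (.inr r) / net.maxStation ν ≤ η * √(net.J : ℝ))
    (hJ1 : 1 ≤ net.J) (hJ2 : K * (1 + η * √(net.J : ℝ)) ≤ net.J / 2)
    (hJ3 : (1 + 2 * C / κ) / (κ / 2) ≤ Real.exp (-(C / 2)) * √(net.J : ℝ)) :
    |marginal M π e x - ∏ k, net.approxMass ν δ (e k) (x k)| ≤
      2 / (κ * Real.exp (-(C / 2))) * (∑ k, (x k : ℝ) + K * (m₁ + η * √(net.J : ℝ))) /
        √(net.J : ℝ) * ∏ k, net.approxMass ν δ (e k) (x k) := by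
  have hmax : 0 < net.maxStation ν := by
    refine lt_of_le_of_ne (net.maxStation_nonneg hν) fun h => ?_
    -- A zero maximum would make the ratio 0 by the convention on division, contradicting `0 < c`.
    rw [← h, div_zero] at hcomp
    linarith
  rw [le_div_iff₀ hmax] at hcomp
  have hδ' : 0 < 1 - δ := by linarith
  have hγ : 0 < net.gammaFactor ν δ := div_pos hδ' hmax
  have hm₁0 : 0 ≤ m₁ := by rw [hm₁]; positivity
  have hm₀ : 0 < (1 - δ) * c := by positivity
  set ρ : Node net.q → ℝ := fun a => net.gammaFactor ν δ * net.utilization ν a with hρ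
  have hρeq : ∀ a, ρ a = (1 - δ) * (net.utilization ν a / net.maxStation ν) := by
    intro a
    simp only [hρ, gammaFactor]
    ring
  have hst_le : ∀ j, ρ (.inl j) ≤ 1 - δ := by
    intro j
    rw [hρeq]
    exact mul_le_of_le_one_right hδ'.le ((div_le_one hmax).2 (net.utilization_le_maxStation j))
  have hst_ge : ∀ j, (1 - δ) * c ≤ ρ (.inl j) := by
    intro j
    rw [hρeq]
    refine mul_le_mul_of_nonneg_left ?_ hδ'.le
    rw [le_div_iff₀ hmax]
    exact hcomp.trans (net.minStation_le_utilization j)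
  have hstpos : ∀ j, 0 < net.utilization ν (.inl j) := fun j =>
    (mul_pos hc hmax).trans_le (hcomp.trans (net.minStation_le_utilization j))
  -- Positivity of `ν` is read off from the lower bound on the utilizations, without recourse to
  -- irreducibility.
  have hνpos : ∀ j, 0 < ν j := by
    intro j
    have h1 : 0 < ν j / (2 * net.μ (.inl j)) := hstpos j
    exact (div_pos_iff_of_pos_right (by linarith [net.μ_pos (.inl j)])).1 h1
  have hρpos : ∀ a, 0 < ρ a := by
    intro a
    refine mul_pos hγ ?_
    rcases a with j | r
    · exact hstpos j
    · exact div_pos (mul_pos (hνpos _) r.2) (by linarith [net.μ_pos (.inr r)])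
  have hmean_le : ∀ j, ρ (.inl j) / (1 - ρ (.inl j)) ≤ m₁ := by
    intro j
    rw [hm₁]
    have := hst_le j
    exact div_le_div₀ hδ'.le this hδ0 (by linarith)
  have hmean_ge : ∀ j, (1 - δ) * c ≤ ρ (.inl j) / (1 - ρ (.inl j)) := by
    intro j
    refine (hst_ge j).trans ?_
    have := hst_le j
    exact le_div_self (hρpos _).le (by linarith) (by linarith [hρpos (.inl j)])
  have hw0 : ∀ a k, 0 < net.approxMass ν δ a k := by
    intro a k
    rcases a with j | r
    · exact geometricMass_pos (hρpos _) (by linarith [hst_le j]) k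
    · exact poissonMass_pos (hρpos (.inr r)) k
  have hws : ∀ a, Summable (net.approxMass ν δ a) := by
    intro a
    rcases a with j | r
    · exact summable_geometricMass (hρpos _).le (by linarith [hst_le j])
    · exact summable_poissonMass _
  have hbounds : ∀ a, CharFunBounds κ C (fourierSeries (net.approxMass ν δ a))
      (net.approxMean (ρ a) a) (net.approxVar (ρ a) a) (net.approxScale (ρ a) a) := by
    intro a
    rw [hκ, hC]
    rcases a with j | r
    · exact charFunBounds_geometric hm₀ (hρpos _).le (by linarith [hst_le j]) (hmean_ge j)
        (hmean_le j)
    · exact charFunBounds_poisson hm₀ hm₁0 (hρpos (.inr r)).le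
  have htotal : net.totalMean ν δ = ∑ a, net.approxMean (ρ a) a := by
    rw [Fintype.sum_sum_type]
    rfl
  rw [htotal] at hM
  have hform : ∀ n ∈ configurations (Node net.q) M, π n * ∑ f ∈ configurations (Node net.q) M,
      ∏ b, net.approxMass ν δ b (f b) = ∏ b, net.approxMass ν δ b (n b) := fun n hn =>
    hπ.mul_sum_eq_prod net.departureRate_zero net.departureRate_pos net.routing_nonneg
      net.routing_row_sum net.routing_connected (net.traffic_equation hν _)
      (net.approxMass_succ_mul δ) hw0 hn
  have hκ0 : 0 < κ := hκ ▸ decayRate_pos hm₀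
  have hC0 : 0 ≤ C := hC ▸ (boundConst_pos hm₁0).le
  set S := ∑ a, net.approxScale (ρ a) a with hS
  -- Each station contributes scale 1, so the stations alone provide the required fluctuations.
  have hJS : (net.J : ℝ) ≤ S := by
    have h1 : S = ∑ j : Fin net.J, (1 : ℝ) + ∑ r : Route net.q, ρ (.inr r) := by
      rw [hS, Fintype.sum_sum_type]
      rfl
    rw [h1]
    have h2 : 0 ≤ ∑ r : Route net.q, ρ (.inr r) := Finset.sum_nonneg fun r _ => (hρpos _).le
    simpa using h2
  have hJ1' : (1 : ℝ) ≤ net.J := by exact_mod_cast hJ1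
  have hsqJ : 0 < √(net.J : ℝ) := Real.sqrt_pos.2 (by linarith)
  have hηJ : 0 ≤ η * √(net.J : ℝ) := by positivity
  have hroute : ∀ k r, e k = .inr r → ρ (.inr r) ≤ η * √(net.J : ℝ) := by
    intro k r hk
    rw [hρeq]
    have h1 := hη k r hk
    have h2 : 0 ≤ net.utilization ν (.inr r) / net.maxStation ν :=
      div_nonneg (net.utilization_nonneg hν _) hmax.le
    nlinarith
  have hscale : ∀ k, net.approxScale (ρ (e k)) (e k) ≤ 1 + η * √(net.J : ℝ) := by
    intro k
    rcases hk : e k with j | r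
    · change (1 : ℝ) ≤ _
      linarith
    · change ρ (.inr r) ≤ _
      linarith [hroute k r hk]
  have hmean : ∀ k, net.approxMean (ρ (e k)) (e k) ≤ m₁ + η * √(net.J : ℝ) := by
    intro k
    rcases hk : e k with j | r
    · change ρ (.inl j) / (1 - ρ (.inl j)) ≤ _
      linarith [hmean_le j]
    · change ρ (.inr r) ≤ _
      linarith [hroute k r hk]
  have hsumscale : ∑ k, net.approxScale (ρ (e k)) (e k) ≤ S / 2 := by
    have := Finset.sum_le_card_nsmul Finset.univ _ _ fun k _ => hscale k
    rw [Finset.card_univ, Fintype.card_fin, nsmul_eq_mul] at this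
    linarith
  have hsummean : ∑ k, ((x k : ℝ) + net.approxMean (ρ (e k)) (e k)) ≤
      ∑ k, (x k : ℝ) + K * (m₁ + η * √(net.J : ℝ)) := by
    have := Finset.sum_le_card_nsmul Finset.univ _ _ fun k _ => hmean k
    rw [Finset.card_univ, Fintype.card_fin, nsmul_eq_mul] at this
    rw [Finset.sum_add_distrib]
    linarith
  have hsqrt : √(net.J : ℝ) ≤ √S := Real.sqrt_le_sqrt hJS
  refine (abs_marginal_sub_prod_le hκ0 hC0 hw0 hws hbounds hM.le hform he x hS (hJ1'.trans hJS)
    hsumscale (hJ3.trans (by gcongr))).trans ?_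
  have hprod : 0 ≤ ∏ k, net.approxMass ν δ (e k) (x k) :=
    Finset.prod_nonneg fun k _ => (hw0 _ _).le
  have hT0 : 0 ≤ ∑ k, (x k : ℝ) + K * (m₁ + η * √(net.J : ℝ)) := by positivity
  refine mul_le_mul_of_nonneg_right ?_ hprod
  exact div_le_div₀ (by positivity) (by gcongr) hsqJ hsqrt

end Network

/-! ### The degenerate case and the passage to the limit. -/

/-- The degenerate case `δ = 1`, in which the network contains no bikes. -/
lemma Network.marginal_eq_of_no_bikes (net : Network) {ν : Fin net.J → ℝ} {M : ℕ}
    (hM : |(M : ℝ) - net.totalMean ν 1| < 1) {π : (Node net.q → ℕ) → ℝ}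
    (hπ : net.IsStationary M π) {K : ℕ} (e : Fin K → Node net.q) (x : Fin K → ℕ) :
    marginal M π e x = ∏ k, net.approxMass ν 1 (e k) (x k) := by
  have hγ : net.gammaFactor ν 1 = 0 := by simp [Network.gammaFactor]
  have htotal : net.totalMean ν 1 = 0 := by simp [Network.totalMean, hγ]
  have hM0 : M = 0 := by
    rw [htotal, sub_zero, Nat.abs_cast] at hM
    exact_mod_cast Nat.lt_one_iff.1 (by exact_mod_cast hM)
  subst hM0
  have hconf : configurations (Node net.q) 0 = {0} := by
    simp [configurations]
  have hmass : ∀ a k, net.approxMass ν 1 a k = if 0 = k then 1 else 0 := by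
    intro a k
    rcases a with j | r
    · change geometricMass _ k = _
      rw [hγ, zero_mul, geometricMass]
      rcases k with _ | k <;> simp
    · change poissonMass _ k = _
      rw [hγ, zero_mul, poissonMass]
      rcases k with _ | k <;> simp
  have h1 := hπ.sum_eq_one
  rw [hconf, Finset.sum_singleton] at h1
  simp_rw [hmass]
  rw [marginal, hconf, Finset.sum_filter, Finset.sum_singleton, h1, Finset.prod_ite_zero]
  simp

lemma tendsto_add_mul_div_zero {u η : ℕ → ℝ} (hu : Tendsto u atTop atTop)
    (hη : Tendsto η atTop (𝓝 0)) (a b : ℝ) :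
    Tendsto (fun N => (a + b * (η N * u N)) / u N) atTop (𝓝 0) := by
  have h1 : Tendsto (fun N => a / u N + b * η N) atTop (𝓝 (0 + b * 0)) :=
    (hu.const_div_atTop a).add (hη.const_mul b)
  rw [mul_zero, add_zero] at h1
  refine h1.congr' ?_
  filter_upwards [hu.eventually_gt_atTop 0] with N hN
  field_simp

/-- There are at most `J²` routes, so the number of nodes can only diverge if `J` does. -/
lemma tendsto_J_atTop {net : ℕ → Network}
    (hsize : Tendsto (fun N => (net N).numNodes) atTop atTop) :
    Tendsto (fun N => (net N).J) atTop atTop := by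
  refine tendsto_atTop.2 fun b => ?_
  filter_upwards [hsize.eventually_gt_atTop (b + b * b)] with N hN
  by_contra! h
  have h1 := (net N).numNodes_le
  have h2 := Nat.mul_le_mul h.le h.le
  omega

/-- Asymptotic independence of nodes whose utilizations are negligible compared to the fluctuations
of the number of bikes at the stations. -/
theorem eventually_abs_marginal_sub_prod_le {net : ℕ → Network}
    (hsize : Tendsto (fun N => (net N).numNodes) atTop atTop) {ν : ∀ N, Fin (net N).J → ℝ}
    (hν : ∀ N, IsInvariantDistribution (net N).q (ν N)) {δ : ℝ} (hδ0 : 0 < δ) (hδ1 : δ < 1)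
    {M : ℕ → ℕ} (hM : ∀ N, |(M N : ℝ) - (net N).totalMean (ν N) δ| < 1)
    {π : ∀ N, (Node (net N).q → ℕ) → ℝ} (hπ : ∀ N, (net N).IsStationary (M N) (π N))
    (hcomp : 0 < liminf (fun N => (net N).minStation (ν N) / (net N).maxStation (ν N)) atTop)
    {η : ℕ → ℝ} (hη0 : ∀ N, 0 ≤ η N) (hη : Tendsto η atTop (𝓝 0))
    (K : ℕ) (x : Fin K → ℕ) {ε : ℝ} (hε : 0 < ε) :
    ∀ᶠ N in atTop, ∀ e : Fin K → Node (net N).q, Function.Injective e →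
      (∀ k r, e k = .inr r → (net N).utilization (ν N) (.inr r) / (net N).maxStation (ν N) ≤
        η N * √((net N).J : ℝ)) →
      |marginal (M N) (π N) e x - ∏ k, (net N).approxMass (ν N) δ (e k) (x k)| ≤
        ε * ∏ k, (net N).approxMass (ν N) δ (e k) (x k) := by
  obtain ⟨c, hc0, hclt⟩ := exists_between hcomp
  have hbdd : IsBoundedUnder (· ≥ ·) atTop
      fun N => (net N).minStation (ν N) / (net N).maxStation (ν N) :=
    isBoundedUnder_of ⟨0, fun N =>
      div_nonneg ((net N).minStation_nonneg (hν N)) ((net N).maxStation_nonneg (hν N))⟩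
  have hratio := eventually_lt_of_lt_liminf hclt hbdd
  have hJ := tendsto_J_atTop hsize
  have hu : Tendsto (fun N => √((net N).J : ℝ)) atTop atTop :=
    Real.tendsto_sqrt_atTop.comp (tendsto_natCast_atTop_atTop.comp hJ)
  set κ := decayRate ((1 - δ) * c) with hκ
  set m₁ := (1 - δ) / δ with hm₁
  set C := boundConst m₁ with hC
  have h1 : ∀ᶠ N in atTop, K * (1 + η N * √((net N).J : ℝ)) ≤ (net N).J / 2 := by
    have ht := tendsto_add_mul_div_zero hu hη K K
    filter_upwards [ht.eventually_le_const (show (0 : ℝ) < 1 / 2 by norm_num),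
      hu.eventually_ge_atTop 1] with N hN hN1
    rw [div_le_iff₀ (by linarith)] at hN
    have h2 : √((net N).J : ℝ) * √((net N).J : ℝ) = (net N).J :=
      Real.mul_self_sqrt (Nat.cast_nonneg _)
    nlinarith
  have h2 : ∀ᶠ N in atTop,
      (1 + 2 * C / κ) / (κ / 2) ≤ Real.exp (-(C / 2)) * √((net N).J : ℝ) :=
    (hu.const_mul_atTop (Real.exp_pos _)).eventually_ge_atTop _
  have h3 : ∀ᶠ N in atTop, 2 / (κ * Real.exp (-(C / 2))) *
      (∑ k, (x k : ℝ) + K * (m₁ + η N * √((net N).J : ℝ))) / √((net N).J : ℝ) ≤ ε := by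
    have ht := (tendsto_add_mul_div_zero hu hη (∑ k, (x k : ℝ) + K * m₁) K).const_mul
      (2 / (κ * Real.exp (-(C / 2))))
    rw [mul_zero] at ht
    filter_upwards [ht.eventually_le_const hε] with N hN
    refine le_trans (le_of_eq ?_) hN
    ring
  filter_upwards [hratio, h1, h2, h3, hJ.eventually_ge_atTop 1] with N hN hN1 hN2 hN3 hN4 e he hsmall
  refine ((net N).abs_marginal_sub_prod_approxMass_le (hν N) hδ0 hδ1 hc0 hN.le (hM N) (hπ N) hκ hm₁
    hC he x (hη0 N) hsmall hN4 hN1 hN2).trans (mul_le_mul_of_nonneg_right hN3 ?_)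
  have hγ : 0 ≤ (net N).gammaFactor (ν N) δ :=
    div_nonneg (by linarith) ((net N).maxStation_nonneg (hν N))
  have hmax : 0 < (net N).maxStation (ν N) := by
    refine lt_of_le_of_ne ((net N).maxStation_nonneg (hν N)) fun h => ?_
    rw [← h, div_zero] at hN
    linarith
  refine Finset.prod_nonneg fun k _ => ?_
  rcases e k with j | r
  · have h4 : (net N).gammaFactor (ν N) δ * (net N).utilization (ν N) (.inl j) ≤ 1 - δ := by
      rw [Network.gammaFactor, div_mul_eq_mul_div, div_le_iff₀ hmax]
      exact mul_le_mul_of_nonneg_left ((net N).utilization_le_maxStation j) (by linarith)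
    exact mul_nonneg (by linarith)
      (pow_nonneg (mul_nonneg hγ ((net N).utilization_nonneg (hν N) _)) _)
  · have h4 := mul_nonneg hγ ((net N).utilization_nonneg (hν N) (.inr r))
    change 0 ≤ poissonMass _ _
    unfold poissonMass
    positivity

end BikeSharing

end

theorem corollary5p1
    -- a sequence of networks whose number of nodes tends to infinity
    (net : ℕ → BikeSharing.Network)
    (hsize : Tendsto (fun N => (net N).numNodes) atTop atTop)
    (ν : ∀ N, Fin (net N).J → ℝ)
    (hν : ∀ N, BikeSharing.IsInvariantDistribution (net N).q (ν N))
    (δ : ℝ) (hδ0 : 0 < δ) (hδ1 : δ ≤ 1)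
    -- the number of bikes is the total mean of the free variables, rounded to an integer
    -- if necessary
    (M : ℕ → ℕ) (hM : ∀ N, |(M N : ℝ) - (net N).totalMean (ν N) δ| < 1)
    -- the stationary law of the occupation numbers of the nodes
    (π : ∀ N, (BikeSharing.Node (net N).q → ℕ) → ℝ)
    (hπ : ∀ N, (net N).IsStationary (M N) (π N))
    -- the utilizations of the stations are of the same order
    (hcomp : 0 < liminf (fun N => (net N).minStation (ν N) / (net N).maxStation (ν N)) atTop) :
    -- (i) the stations
    (∀ (K : ℕ) (x : Fin K → ℕ) (ε : ℝ), 0 < ε → ∀ᶠ N in atTop,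
      ∀ e : Fin K → Fin (net N).J, Function.Injective e →
        |BikeSharing.marginal (M N) (π N) (fun k => Sum.inl (e k)) x -
            ∏ k, (net N).approxMass (ν N) δ (Sum.inl (e k)) (x k)| ≤
          ε * ∏ k, (net N).approxMass (ν N) δ (Sum.inl (e k)) (x k)) ∧
    -- (ii) the stations and the routes
    (Tendsto (fun N => (net N).maxRoute (ν N) /
        (√((net N).J : ℝ) * (net N).maxStation (ν N))) atTop (𝓝 0) →
      ∀ (K : ℕ) (x : Fin K → ℕ) (ε : ℝ), 0 < ε → ∀ᶠ N in atTop,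
        ∀ e : Fin K → BikeSharing.Node (net N).q, Function.Injective e →
          |BikeSharing.marginal (M N) (π N) e x -
              ∏ k, (net N).approxMass (ν N) δ (e k) (x k)| ≤
            ε * ∏ k, (net N).approxMass (ν N) δ (e k) (x k)) := by
  rcases hδ1.lt_or_eq with hδ1 | rfl
  · constructor
    · intro K x ε hε
      filter_upwards [BikeSharing.eventually_abs_marginal_sub_prod_le hsize hν hδ0 hδ1 hM hπ hcomp
        -- No route is observed, so the smallness condition is vacuous and `η = 0` will do.
        (η := fun _ => 0) (fun _ => le_rfl) tendsto_const_nhds K x hε] with N hN e he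
      exact hN _ (Sum.inl_injective.comp he) (fun k r h => by simp at h)
    · intro hroute K x ε hε
      filter_upwards [BikeSharing.eventually_abs_marginal_sub_prod_le hsize hν hδ0 hδ1 hM hπ hcomp
        (fun N => div_nonneg ((net N).maxRoute_nonneg (hν N))
          (mul_nonneg (Real.sqrt_nonneg _) ((net N).maxStation_nonneg (hν N)))) hroute K x hε,
        (BikeSharing.tendsto_J_atTop hsize).eventually_ge_atTop 1] with N hN hJ e he
      refine hN e he fun k r _ => ?_
      have hs : 0 < √((net N).J : ℝ) := Real.sqrt_pos.2 (by exact_mod_cast hJ)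
      -- Here `η` is the ratio assumed to tend to 0, so `η √J` is the largest route utilization
      -- relative to the largest station utilization.
      have h1 : (net N).maxRoute (ν N) / (√((net N).J : ℝ) * (net N).maxStation (ν N)) *
          √((net N).J : ℝ) = (net N).maxRoute (ν N) / (net N).maxStation (ν N) := by
        rw [mul_comm (√((net N).J : ℝ)), ← div_div, div_mul_cancel₀ _ hs.ne']
      rw [h1]
      exact div_le_div_of_nonneg_right ((net N).utilization_le_maxRoute r)
        ((net N).maxStation_nonneg (hν N))
  · have hprod : ∀ N {K : ℕ} (e : Fin K → BikeSharing.Node (net N).q) (x : Fin K → ℕ),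
        BikeSharing.marginal (M N) (π N) e x = ∏ k, (net N).approxMass (ν N) 1 (e k) (x k) :=
      fun N _ e x => (net N).marginal_eq_of_no_bikes (hM N) (hπ N) e x
    have hnonneg : ∀ N {K : ℕ} (e : Fin K → BikeSharing.Node (net N).q) (x : Fin K → ℕ),
        0 ≤ ∏ k, (net N).approxMass (ν N) 1 (e k) (x k) := by
      intro N K e x
      rw [← hprod]
      exact Finset.sum_nonneg fun n _ => (hπ N).nonneg n
    constructor
    · intro K x ε hε
      refine Eventually.of_forall fun N e _ => ?_
      rw [hprod, sub_self, abs_zero]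
      exact mul_nonneg hε.le (hnonneg N _ x)
    · intro _ K x ε hε
      refine Eventually.of_forall fun N e _ => ?_
      rw [hprod, sub_self, abs_zero]
      exact mul_nonneg hε.le (hnonneg N e x)
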